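/- Let $n\ge 2$, $p\in[0,1]$, $\varepsilon\in[0,\tfrac12)$ and $z\in\{\pm1\}^n$. Let $G$ be an Erdős–Rényi graph $\mathcal G(n,p)$ on $n$ nodes. Let $Y$ be the random symmetric $n\times n$ matrix with $Y_{ij}=0$ if $\{i,j\}$ is not an edge of $G$ (in particular $Y_{ii}=0$) and, independently for each edge $\{i,j\}$ of $G$, $Y_{ij}=z_iz_j$ with probability $1-\varepsilon$ and $Y_{ij}=-z_iz_j$ with probability $\varepsilon$. Consider the $\mathbb Z_2$-synchronization semidefinite program $$\max\ \operatorname{Tr}(YX)\quad\text{subject to } X\in\mathbb R^{n\times n}\text{ symmetric},\ X_{ii}=1 \text{ for all } i,\ X\succeq 0,$$ and say that it achieves exact recovery if $X=zz^T$ is its unique optimal solution. There is an absolute constant $K$ such that for every $\delta>0$ there are $c>0$ and $N$, depending only on $\delta$, for which the following holds. If $n\ge N$, $0\le\varepsilon<\tfrac12$, $p(1-2\varepsilon)^2\le\tfrac12$ and $$(n-1)p\ \ge\ (1+\delta)\,\frac{2}{(1-2\varepsilon)^2}\left[1+\frac{K}{\sqrt{\log n}}+\frac53(1-2\varepsilon)\right]\log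 n,$$ then, for every $z\in\{\pm1\}^n$, the semidefinite program achieves exact recovery with probability at least $1-n^{-c}$. -/

import Mathlib

open MeasureTheory

noncomputable section

namespace Z2Sync

/-- The matrix of noisy relative measurements of the labels `z`: `G` is the graph of measured pairs
and `F` marks the pairs at which a measurement, if it is made, comes out with the wrong sign. So
`Y i j` is `z i * z j` on the edges of `G` outside `F`, it is `-(z i * z j)` on the edges of `G` that
lie in `F`, and it is `0` on the pairs that are not edges of `G`. -/
def measurements {n : ℕ} (z : Fin n → ℝ) (G F : SimpleGraph (Fin n)) :
    Matrix (Fin n) (Fin n) ℝ :=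
  open Classical in
  fun i j => if G.Adj i j then (if F.Adj i j then -(z i * z j) else z i * z j) else 0

/-- With `H = G ⊓ F` the graph of corrupted measurements, the measurement matrix is
`diag(z) (A_G - 2 A_H) diag(z)`. -/
theorem measurements_eq {n : ℕ} (z : Fin n → ℝ) (G F : SimpleGraph (Fin n))
    [DecidableRel G.Adj] [DecidableRel (G ⊓ F).Adj] :
    measurements z G F =
      Matrix.diagonal z * (G.adjMatrix ℝ - (2 : ℝ) • (G ⊓ F).adjMatrix ℝ) * Matrix.diagonal z := by
  ext i j
  rw [Matrix.mul_diagonal, Matrix.diagonal_mul]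
  by_cases hG : G.Adj i j <;> by_cases hF : F.Adj i j <;>
    simp [measurements, SimpleGraph.adjMatrix_apply, hG, hF]
  ring

/-- The law of the pair `(G, F)`. The graph `G` of measured pairs is an Erdős–Rényi graph `G(n, p)`;
independently of it, each pair of nodes is marked as corrupted with probability `ε`, independently
over the pairs, that is, the graph `F` of the marked pairs has the law `G(n, ε)`. -/
def model (n : ℕ) (p ε : unitInterval) :
    Measure (SimpleGraph (Fin n) × SimpleGraph (Fin n)) :=
  (SimpleGraph.binomialRandom (Fin n) p).prod (SimpleGraph.binomialRandom (Fin n) ε)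

/-- The feasible set of the semidefinite program: real positive semidefinite (in particular
symmetric) matrices with unit diagonal. -/
def feasible (n : ℕ) : Set (Matrix (Fin n) (Fin n) ℝ) :=
  {X | X.PosSemidef ∧ ∀ i, X i i = 1}

/-- `X` is an optimal solution of: maximize `Tr (Y X)` subject to `X i i = 1` and `X ⪰ 0`. -/
def IsOptimal {n : ℕ} (Y X : Matrix (Fin n) (Fin n) ℝ) : Prop :=
  X ∈ feasible n ∧ IsMaxOn (fun X' => (Y * X').trace) (feasible n) X

/-- The semidefinite program with coefficient matrix `Y` exactly recovers `z`: the matrix `z zᵀ` is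
its unique optimal solution. -/
def ExactRecovery {n : ℕ} (z : Fin n → ℝ) (Y : Matrix (Fin n) (Fin n) ℝ) : Prop :=
  ∀ X : Matrix (Fin n) (Fin n) ℝ, IsOptimal Y X ↔ X = Matrix.vecMulVec z z

end Z2Sync

end

/-!
Write `η = 1 - 2 ε` and `d = (n - 1) p`. Multiplying row `i` and column `i` of `Y` by `z i` turns the
measurements into a symmetric matrix `W` with zero diagonal and independent entries in `{-1, 0, 1}`
of mean `p η`, and `zzᵀ` into the all-ones matrix `J`. Let `D` be the diagonal matrix of the row
sums of `W`.

*Duality.* If `D - W` is positive definite modulo constant vectors, then `zzᵀ` is the unique optimum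
(`exactRecovery_of_laplacianForm_pos`). On vectors of mean zero the expectation `p η (J - I)` of `W`
only helps, so it suffices that every row sum of `W` exceeds the operator norm of the centred matrix
`W - p η (J - I)` (`exactRecovery_of_rowSum_gt`).

*Row sums.* Chernoff's bound with parameter `η` shows that a row sum is at most `t` with probability
at most `exp (η t - d η² / 2)` (`model_real_rowSum_le`). Since `d η² / 2 ≥ (1 + δ) log n`, this
survives a union bound over the `n` rows as long as `t = O(√d)`, because then
`η t = O(√(d η²))` is of lower order than `d η²`.

*The norm.* The centred matrix has norm `O(√d)` with overwhelming probability
(`model_real_le_euclideanOpNorm`). This is where a logarithmic factor must not be lost. The `2 k`-th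
trace moment, `k` being of the order of `n p`, is a sum over closed walks of length `2 k` which
traverse each of their edges at least twice; such a walk on `v` vertices contributes at most
`p ^ (v - 1)`. Grouping the walks by their coincidence pattern, the sum is at most `n / (2 k)` times
the number of such walks on only `2 k` vertices (`sum_repeatedPattern_pow_le`). That number is in turn
at most the `2 k`-th trace moment of a `2 k × 2 k` matrix whose entries take the values `2` and `-1`
with probabilities `1/3` and `2/3`: they are centred, and all their higher moments are at least `1`
(`HasIIDMoments.sum_trace_pow_le`). The comparison matrix is subgaussian and has dimension
comparable to the exponent, so that a net argument bounds its moment by `(C k) ^ k`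
(`sum_markWeight_trace_pow_le`).
-/

namespace Z2Sync

/-! ### The dual certificate -/

/-- The quadratic form `xᵀ (D - W) x` of the Laplacian of `W`, where `D` is the diagonal matrix of
the row sums of `W`. -/
def laplacianForm {n : ℕ} (W : Matrix (Fin n) (Fin n) ℝ) (x : Fin n → ℝ) : ℝ :=
  ∑ i, ∑ j, W i j * (x i ^ 2 - x i * x j)

/-- For symmetric `W` the form depends only on the differences of the coordinates of `x`. -/
theorem laplacianForm_eq_half_sum_sq {n : ℕ} {W : Matrix (Fin n) (Fin n) ℝ}
    (hW : ∀ i j, W i j = W j i) (x : Fin n → ℝ) :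
    laplacianForm W x = (∑ i, ∑ j, W i j * (x i - x j) ^ 2) / 2 := by
  have h : ∑ i, ∑ j, W i j * (x i ^ 2 - x i * x j)
      = ∑ i, ∑ j, W i j * (x j ^ 2 - x i * x j) := by
    rw [Finset.sum_comm]
    refine Finset.sum_congr rfl fun i _ => Finset.sum_congr rfl fun j _ => ?_
    rw [hW j i]; ring
  have h2 : ∑ i, ∑ j, W i j * (x i - x j) ^ 2 = laplacianForm W x + laplacianForm W x := by
    nth_rewrite 2 [laplacianForm]
    rw [h, laplacianForm, ← Finset.sum_add_distrib]
    refine Finset.sum_congr rfl fun i _ => ?_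
    rw [← Finset.sum_add_distrib]
    exact Finset.sum_congr rfl fun j _ => by ring
  rw [h2]; ring

/-- If the Laplacian of `W` is positive definite modulo constants, then `zzᵀ` is the unique
optimum for the measurements `z i * z j * W i j`. Writing a feasible `X` as `Bᵀ B`, the defect
`Tr (Y zzᵀ) - Tr (Y X)` is the sum of the Laplacian form over the rows of `B diag(z)`. -/
theorem exactRecovery_of_laplacianForm_pos {n : ℕ} {z : Fin n → ℝ} (hz : ∀ i, z i = 1 ∨ z i = -1)
    {W Y : Matrix (Fin n) (Fin n) ℝ} (hY : ∀ i j, Y i j = z i * z j * W i j)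
    (hW : ∀ i j, W i j = W j i)
    (hpos : ∀ x : Fin n → ℝ, (∃ i j, x i ≠ x j) → 0 < laplacianForm W x) :
    ExactRecovery z Y := by
  have hzz : ∀ i, z i * z i = 1 := fun i => by rcases hz i with h | h <;> simp [h]
  have hnonneg : ∀ x, 0 ≤ laplacianForm W x := by
    intro x
    by_cases h : ∃ i j, x i ≠ x j
    · exact (hpos x h).le
    · push Not at h
      rw [laplacianForm_eq_half_sum_sq hW]
      refine le_of_eq (Eq.symm ?_)
      refine div_eq_zero_iff.2 (Or.inl ?_)
      refine Finset.sum_eq_zero fun i _ => Finset.sum_eq_zero fun j _ => ?_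
      rw [h i j]; ring
  have key : ∀ X ∈ feasible n, ∃ (m : ℕ) (B : Fin m → Fin n → ℝ),
      (∀ i j, X i j = ∑ k, B k i * B k j) ∧
      (Y * X).trace = ∑ i, ∑ j, W i j - ∑ k, laplacianForm W (fun i => z i * B k i) := by
    rintro X ⟨hX, hd⟩
    obtain ⟨m, B, hXB⟩ := Matrix.posSemidef_iff_eq_sum_vecMulVec.1 hX
    have hB : ∀ i j, X i j = ∑ k, B k i * B k j := fun i j => by
      simp [hXB, Matrix.sum_apply, Matrix.vecMulVec_apply]
    refine ⟨m, B, hB, ?_⟩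
    have h1 : ∑ k, laplacianForm W (fun i => z i * B k i)
        = ∑ i, ∑ j, ∑ k, W i j * ((z i * B k i) ^ 2 - (z i * B k i) * (z j * B k j)) := by
      simp only [laplacianForm]
      rw [Finset.sum_comm]
      refine Finset.sum_congr rfl fun i _ => ?_
      rw [Finset.sum_comm]
    have h2 : (Y * X).trace
        = ∑ i, ∑ j, z i * z j * W i j * ∑ k, B k i * B k j := by
      simp only [Matrix.trace, Matrix.diag, Matrix.mul_apply]
      refine Finset.sum_congr rfl fun i _ => Finset.sum_congr rfl fun j _ => ?_
      rw [hB, hY]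
      simp only [mul_comm (B _ j)]
    rw [h1, h2, ← Finset.sum_sub_distrib]
    refine Finset.sum_congr rfl fun i _ => ?_
    rw [← Finset.sum_sub_distrib]
    refine Finset.sum_congr rfl fun j _ => ?_
    have h3 : ∑ k, B k i * B k i = 1 := by rw [← hB, hd]
    rw [← Finset.mul_sum, Finset.sum_sub_distrib]
    have h4 : ∑ k, (z i * B k i) ^ 2 = 1 := by
      rw [← h3]
      refine Finset.sum_congr rfl fun k _ => ?_
      linear_combination (B k i ^ 2) * hzz i
    rw [h4, Finset.mul_sum]
    have h5 : ∑ k, z i * B k i * (z j * B k j) = ∑ k, z i * z j * (B k i * B k j) :=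
      Finset.sum_congr rfl fun k _ => by ring
    rw [h5, ← Finset.mul_sum, ← Finset.mul_sum]
    ring
  have hzf : Matrix.vecMulVec z z ∈ feasible n := by
    refine ⟨?_, fun i => by simp [Matrix.vecMulVec_apply, hzz]⟩
    simpa using Matrix.posSemidef_vecMulVec_self_star z
  have hzval : (Y * Matrix.vecMulVec z z).trace = ∑ i, ∑ j, W i j := by
    simp only [Matrix.trace, Matrix.diag, Matrix.mul_apply, Matrix.vecMulVec_apply]
    refine Finset.sum_congr rfl fun i _ => Finset.sum_congr rfl fun j _ => ?_
    rw [hY]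
    linear_combination W i j * (z j * z j) * hzz i + W i j * hzz j
  have hle : ∀ X ∈ feasible n, (Y * X).trace ≤ ∑ i, ∑ j, W i j := by
    intro X hX
    obtain ⟨m, B, -, hB⟩ := key X hX
    rw [hB]
    linarith [Finset.sum_nonneg fun k (_ : k ∈ Finset.univ) =>
      hnonneg (fun i => z i * B k i)]
  intro X
  constructor
  · rintro ⟨hX, hmax⟩
    obtain ⟨m, B, hXB, hB⟩ := key X hX
    have h1 := hmax hzf
    simp only [Set.mem_ofPred_eq] at h1
    rw [hzval, hB] at h1
    have h2 : ∑ k, laplacianForm W (fun i => z i * B k i) = 0 :=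
      le_antisymm (by linarith) (Finset.sum_nonneg fun k _ => hnonneg _)
    rw [Finset.sum_eq_zero_iff_of_nonneg fun k _ => hnonneg _] at h2
    have h3 : ∀ k i j, z i * B k i = z j * B k j := by
      intro k i j
      by_contra hne
      exact (hpos _ ⟨i, j, hne⟩).ne' (h2 k (Finset.mem_univ k))
    ext i j
    rw [hXB, Matrix.vecMulVec_apply]
    have h4 : ∑ k, B k i * B k i = 1 := by rw [← hXB, hX.2]
    calc ∑ k, B k i * B k j = ∑ k, z i * z j * (B k i * B k i) := by
          refine Finset.sum_congr rfl fun k _ => ?_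
          linear_combination (-z j * B k i) * h3 k i j - B k i * B k j * hzz j
      _ = z i * z j := by rw [← Finset.mul_sum, h4, mul_one]
  · rintro rfl
    refine ⟨hzf, fun X hX => ?_⟩
    simp only [Set.mem_ofPred_eq]
    rw [hzval]
    exact hle X hX

/-- Positivity of the Laplacian form modulo constants, when every row sum of `W` exceeds `t` and
`W - a (J - I)` has quadratic form at most `t`: on vectors with mean zero `J` vanishes. -/
theorem laplacianForm_pos_of_rowSum_gt {n : ℕ} {W : Matrix (Fin n) (Fin n) ℝ}
    (hW : ∀ i j, W i j = W j i) (hdiag : ∀ i, W i i = 0) {a t : ℝ} (ha : 0 ≤ a)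
    (hrow : ∀ i, t < ∑ j, W i j)
    (hnorm : ∀ x : Fin n → ℝ,
      ∑ i, ∑ j, (if i = j then 0 else W i j - a) * (x i * x j) ≤ t * ∑ i, x i ^ 2)
    (x : Fin n → ℝ) (hx : ∃ i j, x i ≠ x j) : 0 < laplacianForm W x := by
  obtain ⟨i₀, j₀, hij⟩ := hx
  have hn : (n : ℝ) ≠ 0 := by
    have := i₀.pos
    positivity
  set m : ℝ := (∑ i, x i) / n with hm
  set y : Fin n → ℝ := fun i => x i - m with hy
  have hxy : laplacianForm W x = laplacianForm W y := by
    rw [laplacianForm_eq_half_sum_sq hW, laplacianForm_eq_half_sum_sq hW]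
    simp [hy]
  have hsum : ∑ i, y i = 0 := by
    simp only [hy, Finset.sum_sub_distrib, Finset.sum_const, Finset.card_univ, Fintype.card_fin,
      nsmul_eq_mul, hm]
    field_simp
    ring
  have hypos : ∃ i, 0 < y i ^ 2 := by
    by_contra! h
    have h0 : ∀ i, x i = m := fun i => by
      have : y i = 0 := pow_eq_zero_iff (two_ne_zero) |>.1 (le_antisymm (h i) (sq_nonneg _))
      simpa [hy, sub_eq_zero] using this
    exact hij (by rw [h0, h0])
  have hform : laplacianForm W y = ∑ i, (∑ j, W i j) * y i ^ 2
      - ∑ i, ∑ j, (if i = j then 0 else W i j - a) * (y i * y j)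
      - a * ((∑ i, y i) * (∑ j, y j)) + a * ∑ i, y i ^ 2 := by
    have e1 : ∀ i j, (if i = j then 0 else W i j - a) * (y i * y j)
        = W i j * (y i * y j) - a * (y i * y j) + if i = j then a * y j ^ 2 else 0 := by
      intro i j
      split_ifs with h
      · subst h; rw [hdiag]; ring
      · ring
    rw [Finset.sum_mul_sum]
    simp only [e1, laplacianForm, Finset.sum_add_distrib, Finset.sum_sub_distrib, mul_sub,
      Finset.sum_mul, ← Finset.mul_sum, Finset.sum_ite_eq, Finset.mem_univ, if_true]
    ring
  have hlt : t * ∑ i, y i ^ 2 < ∑ i, (∑ j, W i j) * y i ^ 2 := by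
    rw [Finset.mul_sum]
    obtain ⟨i, hi⟩ := hypos
    exact Finset.sum_lt_sum (fun i _ => mul_le_mul_of_nonneg_right (hrow i).le (sq_nonneg _))
      ⟨i, Finset.mem_univ i, mul_lt_mul_of_pos_right (hrow i) hi⟩
  have h2 : 0 ≤ a * ∑ i, y i ^ 2 := mul_nonneg ha (Finset.sum_nonneg fun i _ => sq_nonneg _)
  rw [hxy, hform, hsum]
  linarith [hnorm y]

/-! ### Expectations in the random graph model -/

/-- The unordered pairs of distinct vertices. -/
def edgePairs (V : Type*) [Fintype V] [DecidableEq V] : Finset (Sym2 V) :=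
  Finset.univ.filter fun e => ¬ e.IsDiag

theorem mem_edgePairs {V : Type*} [Fintype V] [DecidableEq V] {e : Sym2 V} :
    e ∈ edgePairs V ↔ ¬ e.IsDiag := by
  simp [edgePairs]

open Classical in
theorem binomialRandom_real_singleton {V : Type*} [Fintype V] [DecidableEq V] (p : unitInterval)
    (G : SimpleGraph V) :
    (SimpleGraph.binomialRandom V p).real {G} =
      ∏ e ∈ edgePairs V, if e ∈ G.edgeSet then (p : ℝ) else 1 - p := by
  have hsub : G.edgeFinset ⊆ edgePairs V := fun e he =>
    mem_edgePairs.2 (G.not_isDiag_of_mem_edgeFinset he)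
  have hcard : (edgePairs V).card = (Fintype.card V).choose 2 := by
    rw [← SimpleGraph.card_edgeFinset_top_eq_card_choose_two]
    congr 1
    ext e
    simp [edgePairs]
  rw [Finset.prod_ite, Finset.prod_const, Finset.prod_const]
  have h1 : (edgePairs V).filter (fun e => e ∈ G.edgeSet) = G.edgeFinset := by
    ext e
    simp only [Finset.mem_filter, SimpleGraph.mem_edgeFinset, and_iff_right_iff_imp]
    exact fun he => hsub (SimpleGraph.mem_edgeFinset.2 he)
  have h2 : ((edgePairs V).filter (fun e => e ∉ G.edgeSet)).card
      = (Fintype.card V).choose 2 - G.edgeFinset.card := by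
    rw [Finset.filter_not, h1, Finset.card_sdiff_of_subset hsub, hcard]
  rw [h1, h2, measureReal_def, SimpleGraph.binomialRandom_singleton, Nat.card_eq_fintype_card,
    ← SimpleGraph.coe_edgeFinset, Set.ncard_coe_finset]
  rw [ENNReal.toReal_mul, ENNReal.toReal_pow, ENNReal.toReal_pow]
  rfl

open Classical in
/-- The expectation of a product over the pairs factorizes: the edges are independent. -/
theorem sum_binomialRandom_mul_prod {V : Type*} [Fintype V] [DecidableEq V] (p : unitInterval)
    (g : Sym2 V → Prop → ℝ) :
    ∑ G : SimpleGraph V, (SimpleGraph.binomialRandom V p).real {G} *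
        ∏ e ∈ edgePairs V, g e (e ∈ G.edgeSet) =
      ∏ e ∈ edgePairs V, ((p : ℝ) * g e True + (1 - p) * g e False) := by
  rw [Finset.prod_add]
  have hd : ∀ t ⊆ edgePairs V, (SimpleGraph.fromEdgeSet (t : Set (Sym2 V))).edgeSet = t := by
    intro t ht
    rw [SimpleGraph.edgeSet_fromEdgeSet]
    ext e
    simp only [Set.mem_sdiff, Finset.mem_coe, and_iff_left_iff_imp]
    intro he
    simpa using mem_edgePairs.1 (ht he)
  have hmem : ∀ (G : SimpleGraph V) e,
      e ∈ (edgePairs V).filter (fun e => e ∈ G.edgeSet) ↔ e ∈ G.edgeSet := fun G e => by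
    rw [Finset.mem_filter, mem_edgePairs, and_iff_right_iff_imp]
    exact fun he => G.not_isDiag_of_mem_edgeSet he
  refine Finset.sum_bij' (fun G _ => (edgePairs V).filter fun e => e ∈ G.edgeSet)
    (fun t _ => SimpleGraph.fromEdgeSet (t : Set (Sym2 V))) ?_ ?_ ?_ ?_ ?_
  · intro G _
    exact Finset.mem_powerset.2 (Finset.filter_subset _ _)
  · intro t _; exact Finset.mem_univ _
  · intro G _
    have h : (((edgePairs V).filter fun e => e ∈ G.edgeSet : Finset _) : Set (Sym2 V))
        = G.edgeSet := Set.ext fun e => hmem G e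
    simp only [h, SimpleGraph.fromEdgeSet_edgeSet]
  · intro t ht
    ext e
    rw [hmem, hd t (Finset.mem_powerset.1 ht), Finset.mem_coe]
  · intro G _
    rw [binomialRandom_real_singleton, ← Finset.prod_mul_distrib,
      ← Finset.prod_sdiff (Finset.filter_subset (fun e => e ∈ G.edgeSet) (edgePairs V)), mul_comm]
    congr 1
    · refine Finset.prod_congr rfl fun e he => ?_
      simp [(hmem G e).1 he]
    · refine Finset.prod_congr rfl fun e he => ?_
      have : e ∉ G.edgeSet := fun h => (Finset.mem_sdiff.1 he).2 ((hmem G e).2 h)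
      simp [this]

open Classical in
theorem sum_model_mul_prod {n : ℕ} (p ε : unitInterval)
    (g : Sym2 (Fin n) → Prop → Prop → ℝ) :
    ∑ ω : SimpleGraph (Fin n) × SimpleGraph (Fin n), (model n p ε).real {ω} *
        ∏ e ∈ edgePairs (Fin n), g e (e ∈ ω.1.edgeSet) (e ∈ ω.2.edgeSet) =
      ∏ e ∈ edgePairs (Fin n),
        ((p : ℝ) * (ε * g e True True + (1 - ε) * g e True False) +
          (1 - p) * (ε * g e False True + (1 - ε) * g e False False)) := by
  rw [Fintype.sum_prod_type]
  refine Eq.trans ?_ (sum_binomialRandom_mul_prod p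
    (fun e a => (ε : ℝ) * g e a True + (1 - ε) * g e a False))
  refine Finset.sum_congr rfl fun G _ => ?_
  refine Eq.trans ?_ (congrArg _
    (sum_binomialRandom_mul_prod ε (fun e b => g e (e ∈ G.edgeSet) b)))
  rw [Finset.mul_sum]
  refine Finset.sum_congr rfl fun F _ => ?_
  rw [model, ← Set.singleton_prod_singleton, measureReal_prod_prod, mul_assoc]

instance model_isProbabilityMeasure (n : ℕ) (p ε : unitInterval) :
    IsProbabilityMeasure (model n p ε) := by
  unfold model; infer_instance

/-- Markov's inequality for the model, in terms of sums over the outcomes. -/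
theorem model_real_le_sum {n : ℕ} (p ε : unitInterval)
    (S : Set (SimpleGraph (Fin n) × SimpleGraph (Fin n)))
    (f : SimpleGraph (Fin n) × SimpleGraph (Fin n) → ℝ) (h0 : ∀ ω, 0 ≤ f ω)
    (h1 : ∀ ω ∈ S, 1 ≤ f ω) :
    (model n p ε).real S ≤ ∑ ω, (model n p ε).real {ω} * f ω := by
  classical
  calc (model n p ε).real S
      ≤ ∑ ω ∈ S.toFinite.toFinset, (model n p ε).real {ω} := by
        refine le_trans (le_of_eq ?_) (measureReal_biUnion_finset_le S.toFinite.toFinset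
          (fun ω => {ω}))
        simp
    _ ≤ ∑ ω ∈ S.toFinite.toFinset, (model n p ε).real {ω} * f ω :=
        Finset.sum_le_sum fun ω hω =>
          le_mul_of_one_le_right measureReal_nonneg (h1 ω (by simpa using hω))
    _ ≤ _ := Finset.sum_le_univ_sum_of_nonneg fun ω => mul_nonneg measureReal_nonneg (h0 ω)

/-! ### Lower tail of the row sums -/

/-- The gauge-transformed measurement of the pair `e`: a missing measurement is `0`, a correct one
is `1` and a corrupted one is `-1`. -/
noncomputable def signedEdge {n : ℕ} (ω : SimpleGraph (Fin n) × SimpleGraph (Fin n))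
    (e : Sym2 (Fin n)) : ℝ :=
  open Classical in
  if e ∈ ω.1.edgeSet then (if e ∈ ω.2.edgeSet then -1 else 1) else 0

theorem measurements_eq_mul_signedEdge {n : ℕ} (z : Fin n → ℝ)
    (ω : SimpleGraph (Fin n) × SimpleGraph (Fin n)) (i j : Fin n) :
    measurements z ω.1 ω.2 i j = z i * z j * signedEdge ω s(i, j) := by
  by_cases hG : ω.1.Adj i j <;> by_cases hF : ω.2.Adj i j <;>
    simp [measurements, signedEdge, hG, hF]

theorem signedEdge_diag {n : ℕ} (ω : SimpleGraph (Fin n) × SimpleGraph (Fin n)) (i : Fin n) :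
    signedEdge ω s(i, i) = 0 := by
  simp [signedEdge]

theorem sum_model_mul_prod_signedEdge {n : ℕ} (p ε : unitInterval)
    (f : Sym2 (Fin n) → ℝ → ℝ) :
    ∑ ω : SimpleGraph (Fin n) × SimpleGraph (Fin n), (model n p ε).real {ω} *
        ∏ e ∈ edgePairs (Fin n), f e (signedEdge ω e) =
      ∏ e ∈ edgePairs (Fin n),
        ((p : ℝ) * (ε * f e (-1) + (1 - ε) * f e 1) + (1 - p) * f e 0) := by
  classical
  have h := sum_model_mul_prod p ε
    (fun e a b => f e (if a then (if b then -1 else 1) else 0))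
  simp only [if_true, if_false] at h
  rw [show (∏ e ∈ edgePairs (Fin n),
        ((p : ℝ) * (ε * f e (-1) + (1 - ε) * f e 1) + (1 - p) * f e 0)) = _ from
      (Finset.prod_congr rfl fun e _ => by ring).trans h.symm]
  refine Finset.sum_congr rfl fun ω _ => ?_
  refine congrArg _ (Finset.prod_congr rfl fun e _ => ?_)
  by_cases hG : e ∈ ω.1.edgeSet <;> by_cases hF : e ∈ ω.2.edgeSet <;>
    simp [signedEdge, hG, hF]

theorem cosh_sub_one_sub_mul_sinh_le {x : ℝ} (hx : 0 ≤ x) :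
    Real.cosh x - 1 - x * Real.sinh x ≤ -x ^ 2 / 2 := by
  have hm : MonotoneOn (fun x : ℝ => x * Real.sinh x - Real.cosh x - x ^ 2 / 2) (Set.Ici 0) := by
    have hder : ∀ y : ℝ, HasDerivAt (fun x : ℝ => x * Real.sinh x - Real.cosh x - x ^ 2 / 2)
        (y * (Real.cosh y - 1)) y := by
      intro y
      have := (((hasDerivAt_id y).mul (Real.hasDerivAt_sinh y)).sub (Real.hasDerivAt_cosh y)).sub
        ((hasDerivAt_pow 2 y).div_const 2)
      refine this.congr_deriv ?_
      simp
      ring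
    refine monotoneOn_of_deriv_nonneg (convex_Ici 0) ?_ ?_ ?_
    · exact fun y _ => (hder y).continuousAt.continuousWithinAt
    · exact fun y _ => (hder y).differentiableAt.differentiableWithinAt
    · intro y hy
      rw [(hder y).deriv]
      rw [interior_Ici] at hy
      exact mul_nonneg (le_of_lt hy) (sub_nonneg.2 (Real.one_le_cosh y))
  have := hm (Set.mem_Ici.2 le_rfl) (Set.mem_Ici.2 hx) hx
  simp at this
  linarith

/-- Chernoff's bound for one row sum at exponent `η = 1 - 2 ε`. -/
theorem model_real_rowSum_le {n : ℕ} (p ε : unitInterval) (hε : (ε : ℝ) ≤ 1 / 2) (i : Fin n)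
    (t : ℝ) :
    (model n p ε).real {ω | ∑ j, signedEdge ω s(i, j) ≤ t} ≤
      Real.exp ((1 - 2 * (ε : ℝ)) * t - ((n : ℝ) - 1) * p * (1 - 2 * (ε : ℝ)) ^ 2 / 2) := by
  classical
  set η : ℝ := 1 - 2 * (ε : ℝ) with hη
  have hη0 : 0 ≤ η := by rw [hη]; linarith
  have hp0 : 0 ≤ (p : ℝ) := p.2.1
  -- the exponential of a row sum is a product over the pairs containing `i`
  set f : Sym2 (Fin n) → ℝ → ℝ := fun e w => if i ∈ e then Real.exp (-(η * w)) else 1 with hf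
  have hinj : Set.InjOn (fun j => s(i, j)) (Finset.univ.erase i : Finset (Fin n)) := by
    intro a _ b _ hab
    exact Sym2.congr_right.1 hab
  have himage : (edgePairs (Fin n)).filter (fun e => i ∈ e)
      = (Finset.univ.erase i).image (fun j => s(i, j)) := by
    ext e
    simp only [Finset.mem_filter, mem_edgePairs, Finset.mem_image, Finset.mem_erase,
      Finset.mem_univ, and_true]
    constructor
    · rintro ⟨hd, hi⟩
      obtain ⟨j, rfl⟩ := Sym2.mem_iff_exists.1 hi
      exact ⟨j, fun h => hd (by simp [h]), rfl⟩
    · rintro ⟨j, hj, rfl⟩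
      exact ⟨by simpa using Ne.symm hj, by simp⟩
  have hprod : ∀ F : Sym2 (Fin n) → ℝ, ∏ e ∈ edgePairs (Fin n), (if i ∈ e then F e else 1)
      = ∏ j ∈ Finset.univ.erase i, F s(i, j) := by
    intro F
    rw [← Finset.prod_filter, himage, Finset.prod_image hinj]
  have hrow : ∀ ω : SimpleGraph (Fin n) × SimpleGraph (Fin n),
      ∏ e ∈ edgePairs (Fin n), f e (signedEdge ω e)
        = Real.exp (-(η * ∑ j, signedEdge ω s(i, j))) := by
    intro ω
    simp only [hf]
    rw [hprod (fun e => Real.exp (-(η * signedEdge ω e))), ← Real.exp_sum]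
    rw [← Finset.add_sum_erase _ _ (Finset.mem_univ i), signedEdge_diag, zero_add,
      Finset.sum_neg_distrib, Finset.mul_sum]
  -- the Laplace transform of one entry at `-η` is `1 + p (cosh η - 1 - η sinh η)`
  have hone : (p : ℝ) * (ε * Real.exp (-(η * -1)) + (1 - ε) * Real.exp (-(η * 1)))
      + (1 - p) * Real.exp (-(η * 0)) ≤ Real.exp (p * (-η ^ 2 / 2)) := by
    have h1 : (p : ℝ) * (ε * Real.exp (-(η * -1)) + (1 - ε) * Real.exp (-(η * 1)))
      + (1 - p) * Real.exp (-(η * 0)) = p * (Real.cosh η - 1 - η * Real.sinh η) + 1 := by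
      rw [Real.cosh_eq, Real.sinh_eq]
      have : (ε : ℝ) = (1 - η) / 2 := by rw [hη]; ring
      rw [this]
      simp
      ring
    rw [h1]
    calc _ ≤ p * (-η ^ 2 / 2) + 1 := by
          gcongr
          exact cosh_sub_one_sub_mul_sinh_le hη0
      _ ≤ _ := Real.add_one_le_exp _
  have hE : ∑ ω : SimpleGraph (Fin n) × SimpleGraph (Fin n), (model n p ε).real {ω} *
      Real.exp (-(η * ∑ j, signedEdge ω s(i, j)))
        ≤ Real.exp (-(((n : ℝ) - 1) * p * η ^ 2 / 2)) := by
    simp only [← hrow]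
    rw [sum_model_mul_prod_signedEdge]
    have h2 : ∀ e ∈ edgePairs (Fin n),
        ((p : ℝ) * (ε * f e (-1) + (1 - ε) * f e 1) + (1 - p) * f e 0)
          = if i ∈ e then (p : ℝ) * (ε * Real.exp (-(η * -1)) + (1 - ε) * Real.exp (-(η * 1)))
              + (1 - p) * Real.exp (-(η * 0)) else 1 := by
      intro e _
      simp only [hf]
      split_ifs <;> ring
    rw [Finset.prod_congr rfl h2, hprod, Finset.prod_const, Finset.card_erase_of_mem
      (Finset.mem_univ i), Finset.card_univ, Fintype.card_fin]
    have hε0 := ε.2.1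
    have hε1 := ε.2.2
    have hp1 := p.2.2
    have h3 : (0 : ℝ) ≤ (p : ℝ) * (ε * Real.exp (-(η * -1)) + (1 - ε) * Real.exp (-(η * 1)))
      + (1 - p) * Real.exp (-(η * 0)) := by
      have h4 : (0 : ℝ) ≤ 1 - p := by linarith
      have h5 : (0 : ℝ) ≤ 1 - ε := by linarith
      positivity
    refine (pow_le_pow_left₀ h3 hone _).trans (le_of_eq ?_)
    rw [← Real.exp_nat_mul, Nat.cast_sub i.pos]
    congr 1
    push_cast
    ring
  calc (model n p ε).real {ω | ∑ j, signedEdge ω s(i, j) ≤ t}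
      ≤ ∑ ω, (model n p ε).real {ω} * Real.exp (η * t - η * ∑ j, signedEdge ω s(i, j)) := by
        refine model_real_le_sum p ε _ _ (fun ω => (Real.exp_pos _).le) fun ω hω => ?_
        rw [Real.one_le_exp_iff]
        rw [← mul_sub]
        exact mul_nonneg hη0 (sub_nonneg.2 hω)
    _ = Real.exp (η * t) * ∑ ω, (model n p ε).real {ω} *
          Real.exp (-(η * ∑ j, signedEdge ω s(i, j))) := by
        rw [Finset.mul_sum]
        refine Finset.sum_congr rfl fun ω _ => ?_
        rw [sub_eq_add_neg, Real.exp_add]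
        ring
    _ ≤ Real.exp (η * t) * Real.exp (-(((n : ℝ) - 1) * p * η ^ 2 / 2)) := by gcongr
    _ = _ := by rw [← Real.exp_add, ← sub_eq_add_neg]

/-! ### Closed walks in which every edge is repeated -/

/-- The edge traversed at step `i` by the walk `u 0, u 1, …, u ℓ`. -/
def walkEdge {V : Type*} {ℓ : ℕ} (u : Fin (ℓ + 1) → V) (i : Fin ℓ) : Sym2 V :=
  s(u i.castSucc, u i.succ)

/-- Walks with the coincidence pattern `S` (that is, `u i = u j` exactly when `S` relates `i` and
`j`) are closed, have no loops, and traverse each of their edges at least twice. -/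
def RepeatedPattern {ℓ : ℕ} (S : Setoid (Fin (ℓ + 1))) : Prop :=
  S 0 (Fin.last ℓ) ∧ (∀ i : Fin ℓ, ¬ S i.castSucc i.succ) ∧
    ∀ i : Fin ℓ, ∃ j, j ≠ i ∧ ((S j.castSucc i.castSucc ∧ S j.succ i.succ) ∨
      (S j.castSucc i.succ ∧ S j.succ i.castSucc))

theorem repeatedPattern_ker_iff {V : Type*} {ℓ : ℕ} (u : Fin (ℓ + 1) → V) :
    RepeatedPattern (Setoid.ker u) ↔ u 0 = u (Fin.last ℓ) ∧ (∀ i, ¬ (walkEdge u i).IsDiag) ∧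
      ∀ i, ∃ j, j ≠ i ∧ walkEdge u j = walkEdge u i := by
  simp [RepeatedPattern, walkEdge, Setoid.ker_def]

/-- A walk is connected, so it has at most one vertex more than it has edges. -/
theorem card_image_le_card_image_walkEdge_add_one {V : Type*} [DecidableEq V] {ℓ : ℕ}
    (u : Fin (ℓ + 1) → V) :
    (Finset.univ.image u).card ≤ (Finset.univ.image (walkEdge u)).card + 1 := by
  induction ℓ with
  | zero => simp
  | succ ℓ ih =>
    have hv : Finset.univ.image u
        = insert (u (Fin.last _)) (Finset.univ.image (fun i : Fin (ℓ + 1) => u i.castSucc)) := by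
      ext x
      simp [Fin.exists_fin_succ', eq_comm, or_comm]
    have he : Finset.univ.image (walkEdge u) = insert (walkEdge u (Fin.last _))
        (Finset.univ.image (walkEdge (fun i : Fin (ℓ + 1) => u i.castSucc))) := by
      ext x
      simp [Fin.exists_fin_succ', walkEdge, eq_comm, or_comm]
    have h := ih (fun i => u i.castSucc)
    rw [hv, he]
    by_cases hnew : u (Fin.last _) ∈ Finset.univ.image (fun i : Fin (ℓ + 1) => u i.castSucc)
    · rw [Finset.insert_eq_of_mem hnew]
      exact h.trans (Nat.add_le_add_right (Finset.card_le_card (Finset.subset_insert _ _)) 1)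
    · have hedge : walkEdge u (Fin.last _) ∉
          Finset.univ.image (walkEdge (fun i : Fin (ℓ + 1) => u i.castSucc)) := by
        intro hmem
        obtain ⟨j, -, hj⟩ := Finset.mem_image.1 hmem
        have hlast : u (Fin.last _) ∈ walkEdge (fun i : Fin (ℓ + 1) => u i.castSucc) j := by
          rw [hj]
          simp [walkEdge]
        rcases Sym2.mem_iff.1 hlast with h' | h'
        · exact hnew (h' ▸ Finset.mem_image_of_mem _ (Finset.mem_univ _))
        · exact hnew (h' ▸ Finset.mem_image_of_mem _ (Finset.mem_univ _))
      rw [Finset.card_insert_of_notMem hnew, Finset.card_insert_of_notMem hedge]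
      omega

/-- The number of times the walk `u` traverses `e`. -/
def traversals {V : Type*} [DecidableEq V] {ℓ : ℕ} (u : Fin (ℓ + 1) → V) (e : Sym2 V) : ℕ :=
  (Finset.univ.filter fun i => walkEdge u i = e).card

theorem two_le_traversals {V : Type*} [DecidableEq V] {ℓ : ℕ} {u : Fin (ℓ + 1) → V}
    {i j : Fin ℓ} (hij : j ≠ i) (h : walkEdge u j = walkEdge u i) :
    2 ≤ traversals u (walkEdge u i) :=
  Finset.one_lt_card.2 ⟨j, by simp [h], i, by simp, hij⟩

theorem two_mul_card_image_walkEdge_le {V : Type*} [DecidableEq V] {ℓ : ℕ}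
    {u : Fin (ℓ + 1) → V} (hu : RepeatedPattern (Setoid.ker u)) :
    2 * (Finset.univ.image (walkEdge u)).card ≤ ℓ := by
  have h := Finset.card_eq_sum_card_image (walkEdge u) (Finset.univ : Finset (Fin ℓ))
  rw [Finset.card_univ, Fintype.card_fin] at h
  refine le_trans ?_ h.symm.le
  rw [mul_comm, ← smul_eq_mul]
  refine Finset.card_nsmul_le_sum _ _ _ fun e he => ?_
  obtain ⟨i, -, rfl⟩ := Finset.mem_image.1 he
  obtain ⟨j, hj, hji⟩ := ((repeatedPattern_ker_iff u).1 hu).2.2 i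
  exact two_le_traversals hj hji

/-! ### Counting walks by their coincidence pattern -/

/-- The walks with a given coincidence pattern are the injections of its set of classes. -/
theorem card_ker_eq {α V : Type*} [Fintype α] [DecidableEq α] [Fintype V] [DecidableEq V]
    (S : Setoid α) [Fintype (Quotient S)] [Fintype {u : α → V // Setoid.ker u = S}] :
    Fintype.card {u : α → V // Setoid.ker u = S}
      = (Fintype.card V).descFactorial (Fintype.card (Quotient S)) := by
  classical
  rw [← Fintype.card_embedding_eq]
  refine Fintype.card_congr ⟨fun u => ⟨Quotient.lift u.1 fun a b h => ?_, ?_⟩,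
    fun f => ⟨fun a => f (Quotient.mk S a), ?_⟩, ?_, ?_⟩
  · obtain ⟨u, rfl⟩ := u
    exact h
  · obtain ⟨u, rfl⟩ := u
    rintro ⟨a⟩ ⟨b⟩ h
    exact Quotient.sound h
  · ext a b
    simp only [Setoid.ker_def, f.injective.eq_iff]
    exact Quotient.eq
  · intro u; rfl
  · intro f
    ext ⟨a⟩
    rfl

theorem card_image_eq_card_quotient_ker {α V : Type*} [Fintype α] [DecidableEq V] (u : α → V)
    [Fintype (Quotient (Setoid.ker u))] :
    (Finset.univ.image u).card = Fintype.card (Quotient (Setoid.ker u)) := by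
  classical
  rw [Fintype.card_congr (Setoid.quotientKerEquivRange u), ← Set.toFinset_card,
    Set.toFinset_range]

/-- Injections into a set of size `n`, weighted by `p` per point beyond the first, are compared with
injections into a set of size `r`: this needs only that each point beyond the first has at least
`n * p` possible images in the smaller set. -/
theorem descFactorial_mul_pow_le {n r k c : ℕ} {p : ℝ} (hp : 0 ≤ p) (hk : n * p ≤ k)
    (hc : 1 ≤ c) (hr : k + c ≤ r + 1) :
    (r : ℝ) * (n.descFactorial c * p ^ (c - 1)) ≤ n * r.descFactorial c := by
  obtain ⟨c, rfl⟩ : ∃ c', c = c' + 1 := ⟨c - 1, by omega⟩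
  have h1 : (n.descFactorial (c + 1) : ℝ) ≤ n * (n : ℝ) ^ c := by
    rw [← pow_succ']
    exact_mod_cast Nat.descFactorial_le_pow n (c + 1)
  have h2 : (r : ℝ) * (k : ℝ) ^ c ≤ r.descFactorial (c + 1) := by
    rcases r with _ | r
    · simp
    · rw [Nat.succ_descFactorial_succ]
      have h3 : k ^ c ≤ r.descFactorial c :=
        (Nat.pow_le_pow_left (by omega) c).trans (Nat.pow_sub_le_descFactorial r c)
      exact_mod_cast Nat.mul_le_mul_left _ h3
  rw [Nat.add_sub_cancel]
  calc (r : ℝ) * (n.descFactorial (c + 1) * p ^ c)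
      ≤ r * ((n * (n : ℝ) ^ c) * p ^ c) := by gcongr
    _ = n * (r * (n * p) ^ c) := by rw [mul_pow]; ring
    _ ≤ n * (r * (k : ℝ) ^ c) := by gcongr
    _ ≤ n * r.descFactorial (c + 1) := by gcongr

open Classical in
/-- The dimension reduction: a weighted count of walks of length `2 k` with repeated edges on `n`
vertices is at most `n / (2 k)` times the unweighted count on `2 k` vertices. -/
theorem sum_repeatedPattern_pow_le {n k : ℕ} {p : ℝ} (hp : 0 ≤ p) (hk : n * p ≤ k) :
    (2 * k : ℝ) * ∑ u : Fin (2 * k + 1) → Fin n,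
        (if RepeatedPattern (Setoid.ker u) then p ^ ((Finset.univ.image u).card - 1) else 0)
      ≤ n * ∑ u : Fin (2 * k + 1) → Fin (2 * k),
        (if RepeatedPattern (Setoid.ker u) then 1 else 0) := by
  have : Fintype (Setoid (Fin (2 * k + 1))) :=
    @Fintype.ofFinite _ (Finite.of_injective (fun S : Setoid (Fin (2 * k + 1)) => S.r)
      fun S T h => Setoid.ext fun a b => by
        have := congrFun (congrFun h a) b
        exact iff_of_eq this)
  have hfib : ∀ (m : ℕ) (f : Setoid (Fin (2 * k + 1)) → ℝ),
      ∑ u : Fin (2 * k + 1) → Fin m, f (Setoid.ker u)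
        = ∑ S, (m.descFactorial (Fintype.card (Quotient S)) : ℝ) * f S := by
    intro m f
    rw [← Finset.sum_fiberwise Finset.univ (fun u : Fin (2 * k + 1) → Fin m => Setoid.ker u)]
    refine Finset.sum_congr rfl fun S _ => ?_
    have h := card_ker_eq (V := Fin m) S
    rw [Fintype.card_fin, Fintype.card_subtype] at h
    rw [← h, ← nsmul_eq_mul, ← Finset.sum_const]
    refine Finset.sum_congr rfl fun u hu => ?_
    rw [(Finset.mem_filter.1 hu).2]
  have hn := hfib n (fun S => if RepeatedPattern S then p ^ (Fintype.card (Quotient S) - 1) else 0)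
  have hr := hfib (2 * k) (fun S => if RepeatedPattern S then 1 else 0)
  have hcard : ∀ u : Fin (2 * k + 1) → Fin n,
      (if RepeatedPattern (Setoid.ker u) then p ^ ((Finset.univ.image u).card - 1) else 0)
      = if RepeatedPattern (Setoid.ker u) then
          p ^ (Fintype.card (Quotient (Setoid.ker u)) - 1) else 0 := fun u => by
    rw [card_image_eq_card_quotient_ker]
  rw [Finset.sum_congr rfl fun u _ => hcard u, hn, hr, Finset.mul_sum, Finset.mul_sum]
  refine Finset.sum_le_sum fun S _ => ?_
  split_ifs with hS
  · have hc1 : 1 ≤ Fintype.card (Quotient S) := Fintype.card_pos_iff.2 ⟨Quotient.mk S 0⟩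
    have hker : Setoid.ker (Quotient.mk S) = S := Setoid.ext fun a b => Quotient.eq
    -- `2 k` steps with repeated edges have at most `k` edges, hence at most `k + 1` vertices
    have hcard2 : Fintype.card (Quotient S) ≤ k + 1 := by
      have h1 := card_image_eq_card_quotient_ker (Quotient.mk S)
      have h2 := card_image_le_card_image_walkEdge_add_one (Quotient.mk S)
      have h3 := two_mul_card_image_walkEdge_le (u := Quotient.mk S) (by rwa [hker])
      have h4 : (Finset.univ.image (Quotient.mk S)).card = Fintype.card (Quotient S) := by
        rw [Finset.image_univ_of_surjective Quotient.mk_surjective, Finset.card_univ]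
      omega
    have h := descFactorial_mul_pow_le (r := 2 * k) hp hk hc1 (by omega)
    push_cast at h
    rw [mul_one]
    exact h
  · simp

/-! ### Trace moments of symmetric matrices with independent entries -/

/-- The symmetric matrix with zero diagonal whose entry at a pair of distinct indices is given by
`x`. -/
def offDiagMatrix {V : Type*} [DecidableEq V] (x : Sym2 V → ℝ) : Matrix V V ℝ :=
  fun i j => if i = j then 0 else x s(i, j)

theorem pow_apply_eq_sum_walks {V : Type*} [Fintype V] [DecidableEq V] (A : Matrix V V ℝ)
    (ℓ : ℕ) (a b : V) :
    (A ^ ℓ) a b = ∑ u : Fin (ℓ + 1) → V,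
      if u 0 = a ∧ u (Fin.last ℓ) = b then ∏ i : Fin ℓ, A (u i.castSucc) (u i.succ) else 0 := by
  induction ℓ generalizing b with
  | zero =>
    rw [← (Equiv.funUnique (Fin 1) V).symm.sum_comp]
    simp only [pow_zero, Matrix.one_apply]
    by_cases h : a = b
    · subst h; simp
    · rw [if_neg h]
      refine (Finset.sum_eq_zero fun x _ => ?_).symm
      rw [if_neg]
      rintro ⟨h1, h2⟩
      exact h (h1.symm.trans h2)
  | succ ℓ ih =>
    rw [pow_succ, Matrix.mul_apply, ← (Fin.snocEquiv (fun _ => V)).sum_comp,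
      Fintype.sum_prod_type]
    have hR : ∀ x : V, ∀ u : Fin (ℓ + 1) → V,
        (if (Fin.snocEquiv (fun _ : Fin (ℓ + 1 + 1) => V)) (x, u) 0 = a ∧
            (Fin.snocEquiv (fun _ : Fin (ℓ + 1 + 1) => V)) (x, u) (Fin.last _) = b then
          ∏ i : Fin (ℓ + 1), A ((Fin.snocEquiv (fun _ : Fin (ℓ + 1 + 1) => V)) (x, u) i.castSucc)
            ((Fin.snocEquiv (fun _ : Fin (ℓ + 1 + 1) => V)) (x, u) i.succ) else 0)
        = if x = b then (if u 0 = a then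
            (∏ i : Fin ℓ, A (u i.castSucc) (u i.succ)) * A (u (Fin.last ℓ)) x else 0) else 0 := by
      intro x u
      have h0 : (Fin.snoc u x : Fin (ℓ + 2) → V) 0 = u 0 := by
        rw [← Fin.castSucc_zero, Fin.snoc_castSucc (α := fun _ => V)]
      have hs : ∀ i : Fin ℓ, (Fin.snoc u x : Fin (ℓ + 2) → V) i.castSucc.succ = u i.succ := by
        intro i
        rw [Fin.succ_castSucc, Fin.snoc_castSucc (α := fun _ => V)]
      have hl : (Fin.snoc u x : Fin (ℓ + 2) → V) (Fin.last (ℓ + 1)) = x :=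
        Fin.snoc_last (α := fun _ => V) _ _
      have hc : ∀ i, (Fin.snoc u x : Fin (ℓ + 2) → V) (Fin.castSucc i) = u i := fun i =>
        Fin.snoc_castSucc (α := fun _ => V) _ _ _
      change (if (Fin.snoc u x : Fin (ℓ + 2) → V) 0 = a ∧
          (Fin.snoc u x : Fin (ℓ + 2) → V) (Fin.last (ℓ + 1)) = b then
        ∏ i : Fin (ℓ + 1), A ((Fin.snoc u x : Fin (ℓ + 2) → V) i.castSucc)
          ((Fin.snoc u x : Fin (ℓ + 2) → V) i.succ) else 0) = _
      rw [Fin.prod_univ_castSucc]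
      simp only [h0, hs, hl, hc, Fin.succ_last]
      by_cases h1 : x = b <;> by_cases h2 : u 0 = a <;> simp [h1, h2]
    simp only [hR]
    rw [Finset.sum_comm]
    simp only [Finset.sum_ite_eq', Finset.mem_univ, if_true]
    simp only [ih, Finset.sum_mul]
    rw [Finset.sum_comm]
    refine Finset.sum_congr rfl fun u _ => ?_
    by_cases h : u 0 = a
    · simp [h]
    · simp [h]

theorem trace_pow_eq_sum_walks {V : Type*} [Fintype V] [DecidableEq V] (A : Matrix V V ℝ)
    (ℓ : ℕ) :
    (A ^ ℓ).trace = ∑ u : Fin (ℓ + 1) → V,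
      if u 0 = u (Fin.last ℓ) then ∏ i : Fin ℓ, A (u i.castSucc) (u i.succ) else 0 := by
  simp only [Matrix.trace, Matrix.diag, pow_apply_eq_sum_walks]
  rw [Finset.sum_comm]
  refine Finset.sum_congr rfl fun u _ => ?_
  by_cases h : u 0 = u (Fin.last ℓ)
  · simp [h]
  · rw [if_neg h]
    refine Finset.sum_eq_zero fun a _ => ?_
    rw [if_neg]
    rintro ⟨h1, h2⟩
    exact h (h1.trans h2.symm)

/-- The family of random variables `X e`, on the finite space `Ω` with weights `w`, is independent
and identically distributed with moments `M q`, in the sense that all joint moments factorize. -/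
def HasIIDMoments {V Ω : Type*} [Fintype V] [DecidableEq V] [Fintype Ω] (w : Ω → ℝ)
    (X : Ω → Sym2 V → ℝ) (M : ℕ → ℝ) : Prop :=
  M 0 = 1 ∧ ∀ q : Sym2 V → ℕ,
    ∑ ω, w ω * ∏ e ∈ edgePairs V, X ω e ^ q e = ∏ e ∈ edgePairs V, M (q e)

theorem prod_walk_eq_prod_pow_traversals {V : Type*} [Fintype V] [DecidableEq V] {ℓ : ℕ}
    (u : Fin (ℓ + 1) → V) (hu : ∀ i, ¬ (walkEdge u i).IsDiag) (x : Sym2 V → ℝ) :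
    ∏ i : Fin ℓ, offDiagMatrix x (u i.castSucc) (u i.succ)
      = ∏ e ∈ edgePairs V, x e ^ traversals u e := by
  have h1 : ∀ i, offDiagMatrix x (u i.castSucc) (u i.succ) = x (walkEdge u i) := fun i => by
    rw [offDiagMatrix, if_neg (fun h => hu i (by simpa [walkEdge] using h)), walkEdge]
  simp only [h1]
  rw [← Finset.prod_fiberwise_of_maps_to (s := Finset.univ) (t := edgePairs V) (g := walkEdge u)
    fun i _ => mem_edgePairs.2 (hu i)]
  refine Finset.prod_congr rfl fun e _ => ?_
  rw [traversals, ← Finset.prod_const]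
  exact Finset.prod_congr rfl fun i hi => by rw [(Finset.mem_filter.1 hi).2]

open Classical in
/-- For centred entries only the closed walks with repeated edges contribute to the expected trace
of a power. -/
theorem HasIIDMoments.sum_trace_pow {V Ω : Type*} [Fintype V] [DecidableEq V] [Fintype Ω]
    {w : Ω → ℝ} {X : Ω → Sym2 V → ℝ} {M : ℕ → ℝ} (h : HasIIDMoments w X M) (hM : M 1 = 0)
    (ℓ : ℕ) :
    ∑ ω, w ω * ((offDiagMatrix (X ω)) ^ ℓ).trace
      = ∑ u : Fin (ℓ + 1) → V, if RepeatedPattern (Setoid.ker u) then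
          ∏ e ∈ Finset.univ.image (walkEdge u), M (traversals u e) else 0 := by
  simp only [trace_pow_eq_sum_walks, Finset.mul_sum]
  rw [Finset.sum_comm]
  refine Finset.sum_congr rfl fun u _ => ?_
  by_cases hc : u 0 = u (Fin.last ℓ)
  swap
  · rw [if_neg fun hu => hc ((repeatedPattern_ker_iff u).1 hu).1]
    simp [hc]
  simp only [if_pos hc]
  by_cases hd : ∀ i, ¬ (walkEdge u i).IsDiag
  swap
  · rw [if_neg fun hu => hd ((repeatedPattern_ker_iff u).1 hu).2.1]
    push Not at hd
    obtain ⟨i, hi⟩ := hd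
    refine Finset.sum_eq_zero fun ω _ => ?_
    rw [Finset.prod_eq_zero (Finset.mem_univ i), mul_zero]
    rw [offDiagMatrix, if_pos (by simpa [walkEdge] using hi)]
  simp only [prod_walk_eq_prod_pow_traversals u hd]
  rw [h.2]
  have hsub : Finset.univ.image (walkEdge u) ⊆ edgePairs V := by
    intro e he
    obtain ⟨i, -, rfl⟩ := Finset.mem_image.1 he
    exact mem_edgePairs.2 (hd i)
  rw [← Finset.prod_subset hsub fun e _ he => ?_]
  · split_ifs with hu
    · rfl
    · rw [repeatedPattern_ker_iff] at hu
      have hu' : ¬ ∀ i, ∃ j, j ≠ i ∧ walkEdge u j = walkEdge u i := fun h' => hu ⟨hc, hd, h'⟩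
      push Not at hu'
      obtain ⟨i, hi⟩ := hu'
      refine Finset.prod_eq_zero (Finset.mem_image_of_mem _ (Finset.mem_univ i)) ?_
      have : traversals u (walkEdge u i) = 1 := by
        refine Finset.card_eq_one.2 ⟨i, ?_⟩
        ext j
        simp only [Finset.mem_filter, Finset.mem_univ, true_and, Finset.mem_singleton]
        exact ⟨fun hj => by_contra fun hne => hi j hne hj, fun hj => by rw [hj]⟩
      rw [this, hM]
  · have : traversals u e = 0 := by
      refine Finset.card_eq_zero.2 (Finset.filter_eq_empty_iff.2 fun i _ hi => he ?_)
      exact hi ▸ Finset.mem_image_of_mem _ (Finset.mem_univ i)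
    rw [this, h.1]

theorem two_le_traversals_of_repeatedPattern {V : Type*} [DecidableEq V] {ℓ : ℕ}
    {u : Fin (ℓ + 1) → V} (hu : RepeatedPattern (Setoid.ker u)) {e : Sym2 V}
    (he : e ∈ Finset.univ.image (walkEdge u)) : 2 ≤ traversals u e := by
  obtain ⟨i, -, rfl⟩ := Finset.mem_image.1 he
  obtain ⟨j, hj, hji⟩ := ((repeatedPattern_ker_iff u).1 hu).2.2 i
  exact two_le_traversals hj hji

/-- Comparison of trace moments: centred entries on `n` vertices with all higher moments at most
`p` against centred entries on `2 k ≥ 2 n p` vertices with all higher moments at least `1`. -/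
theorem HasIIDMoments.sum_trace_pow_le {n k : ℕ} {Ω Ω' : Type*} [Fintype Ω] [Fintype Ω']
    {w : Ω → ℝ} {X : Ω → Sym2 (Fin n) → ℝ} {M : ℕ → ℝ} (h : HasIIDMoments w X M)
    {w' : Ω' → ℝ} {X' : Ω' → Sym2 (Fin (2 * k)) → ℝ} {M' : ℕ → ℝ} (h' : HasIIDMoments w' X' M')
    (hM : M 1 = 0) (hM' : M' 1 = 0) {p : ℝ} (hp0 : 0 ≤ p) (hp1 : p ≤ 1)
    (hMp : ∀ q, 2 ≤ q → |M q| ≤ p) (hM1 : ∀ q, 2 ≤ q → 1 ≤ M' q) (hk : n * p ≤ k) :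
    (2 * k : ℝ) * ∑ ω, w ω * ((offDiagMatrix (X ω)) ^ (2 * k)).trace
      ≤ n * ∑ ω, w' ω * ((offDiagMatrix (X' ω)) ^ (2 * k)).trace := by
  classical
  rw [h.sum_trace_pow hM, h'.sum_trace_pow hM']
  refine le_trans ?_ ((sum_repeatedPattern_pow_le hp0 hk).trans ?_)
  · gcongr with u _
    split_ifs with hu
    · refine (le_abs_self _).trans ?_
      rw [Finset.abs_prod]
      calc ∏ e ∈ Finset.univ.image (walkEdge u), |M (traversals u e)|
          ≤ ∏ e ∈ Finset.univ.image (walkEdge u), p :=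
            Finset.prod_le_prod (fun _ _ => abs_nonneg _) fun e he =>
              hMp _ (two_le_traversals_of_repeatedPattern hu he)
        _ = p ^ (Finset.univ.image (walkEdge u)).card := by rw [Finset.prod_const]
        _ ≤ _ := pow_le_pow_of_le_one hp0 hp1 (by
            have := card_image_le_card_image_walkEdge_add_one u
            omega)
    · exact le_rfl
  · gcongr with u _
    split_ifs with hu
    · have h1 : ∏ e ∈ Finset.univ.image (walkEdge u), (1 : ℝ)
          ≤ ∏ e ∈ Finset.univ.image (walkEdge u), M' (traversals u e) :=
        Finset.prod_le_prod (fun _ _ => zero_le_one) fun e he =>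
          hM1 _ (two_le_traversals_of_repeatedPattern hu he)
      simpa using h1
    · exact le_rfl

/-! ### Operator norms, traces and nets -/

/-- The operator norm of the matrix `A` with respect to the Euclidean norm. -/
noncomputable def euclideanOpNorm {n : ℕ} (A : Matrix (Fin n) (Fin n) ℝ) : ℝ :=
  ‖Matrix.toEuclideanCLM (n := Fin n) (𝕜 := ℝ) A‖

theorem euclideanOpNorm_nonneg {n : ℕ} (A : Matrix (Fin n) (Fin n) ℝ) : 0 ≤ euclideanOpNorm A :=
  norm_nonneg _

theorem dotProduct_mulVec_le {n : ℕ} (A : Matrix (Fin n) (Fin n) ℝ)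
    (x y : EuclideanSpace ℝ (Fin n)) :
    x.ofLp ⬝ᵥ A.mulVec y.ofLp ≤ euclideanOpNorm A * (‖x‖ * ‖y‖) := by
  rw [← Matrix.inner_toEuclideanCLM]
  refine (real_inner_le_norm _ _).trans ?_
  rw [euclideanOpNorm]
  nlinarith [(Matrix.toEuclideanCLM (n := Fin n) (𝕜 := ℝ) A).le_opNorm y, norm_nonneg x]

theorem trace_pow_le_mul_euclideanOpNorm_pow {n : ℕ} (A : Matrix (Fin n) (Fin n) ℝ) (ℓ : ℕ) :
    (A ^ ℓ).trace ≤ n * euclideanOpNorm A ^ ℓ := by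
  have h : ∀ i, (A ^ ℓ) i i ≤ euclideanOpNorm A ^ ℓ := by
    intro i
    have h1 := dotProduct_mulVec_le (A ^ ℓ) (EuclideanSpace.single i 1) (EuclideanSpace.single i 1)
    have h2 : euclideanOpNorm (A ^ ℓ) ≤ euclideanOpNorm A ^ ℓ := by
      have : Nonempty (Fin n) := ⟨i⟩
      rw [euclideanOpNorm, map_pow]
      exact norm_pow_le _ _
    have h3 : (EuclideanSpace.single i (1 : ℝ)).ofLp ⬝ᵥ
        (A ^ ℓ).mulVec (EuclideanSpace.single i (1 : ℝ)).ofLp = (A ^ ℓ) i i := by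
      simp
    rw [h3] at h1
    simpa using h1.trans (by simpa using h2)
  calc (A ^ ℓ).trace ≤ ∑ _i : Fin n, euclideanOpNorm A ^ ℓ := Finset.sum_le_sum fun i _ => h i
    _ = _ := by simp

/-- The operator norm is at most the Frobenius norm. -/
theorem euclideanOpNorm_sq_le_sum_sq {n : ℕ} (A : Matrix (Fin n) (Fin n) ℝ) :
    euclideanOpNorm A ^ 2 ≤ ∑ i, ∑ j, A i j ^ 2 := by
  have h0 : 0 ≤ ∑ i, ∑ j, A i j ^ 2 :=
    Finset.sum_nonneg fun i _ => Finset.sum_nonneg fun j _ => sq_nonneg _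
  rw [← Real.sq_sqrt h0]
  refine pow_le_pow_left₀ (norm_nonneg _) ?_ 2
  refine ContinuousLinearMap.opNorm_le_bound _ (Real.sqrt_nonneg _) fun x => ?_
  refine (sq_le_sq₀ (norm_nonneg _) (by positivity)).1 ?_
  rw [mul_pow, Real.sq_sqrt h0, EuclideanSpace.real_norm_sq_eq, EuclideanSpace.real_norm_sq_eq,
    Finset.sum_mul]
  refine Finset.sum_le_sum fun i _ => ?_
  rw [Matrix.ofLp_toEuclideanCLM]
  exact Finset.sum_mul_sq_le_sq_mul_sq (R := ℝ) Finset.univ (A i) x.ofLp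

/-- For exponents that are powers of two, the norm of a symmetric matrix is bounded by the trace of
its power, by the `C*`-identity. -/
theorem euclideanOpNorm_pow_le_trace_pow {n : ℕ} {A : Matrix (Fin n) (Fin n) ℝ}
    (hA : A.transpose = A) (m : ℕ) :
    euclideanOpNorm A ^ (2 * 2 ^ m) ≤ (A ^ (2 * 2 ^ m)).trace := by
  have hsa : IsSelfAdjoint (Matrix.toEuclideanCLM (n := Fin n) (𝕜 := ℝ) A) := by
    have : IsSelfAdjoint A := by
      rw [IsSelfAdjoint, Matrix.star_eq_conjTranspose, Matrix.conjTranspose_eq_transpose_of_trivial,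
        hA]
    exact this.map _
  have h1 : euclideanOpNorm A ^ (2 ^ m) = euclideanOpNorm (A ^ (2 ^ m)) := by
    rw [euclideanOpNorm, euclideanOpNorm, map_pow, hsa.norm_pow_two_pow]
  have hsymm : ∀ i j, (A ^ (2 ^ m)) i j = (A ^ (2 ^ m)) j i := by
    intro i j
    conv_lhs => rw [← hA, ← Matrix.transpose_pow, Matrix.transpose_apply]
  rw [mul_comm 2, pow_mul, pow_mul, h1]
  refine (euclideanOpNorm_sq_le_sum_sq _).trans (le_of_eq ?_)
  rw [sq (A ^ 2 ^ m), Matrix.trace]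
  refine Finset.sum_congr rfl fun i _ => ?_
  rw [Matrix.diag_apply, Matrix.mul_apply]
  refine Finset.sum_congr rfl fun j _ => ?_
  rw [hsymm j i, sq]

/-- The unit ball of `ℝⁿ` has a `1/2`-net with at most `5 ^ n` points. -/
theorem exists_half_net (n : ℕ) :
    ∃ N : Finset (EuclideanSpace ℝ (Fin n)), N.card ≤ 5 ^ n ∧ (∀ x ∈ N, ‖x‖ ≤ 1) ∧
      ∀ x : EuclideanSpace ℝ (Fin n), ‖x‖ ≤ 1 → ∃ y ∈ N, ‖x - y‖ ≤ 1 / 2 := by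
  classical
  let P : Finset (EuclideanSpace ℝ (Fin n)) → Prop := fun s =>
    (∀ c ∈ s, ‖c‖ ≤ 2) ∧ ∀ c ∈ s, ∀ d ∈ s, c ≠ d → 1 ≤ ‖c - d‖
  have hcard : ∀ s, P s → s.card ≤ 5 ^ n := fun s hs => by
    simpa using Besicovitch.card_le_of_separated s hs.1 hs.2
  -- a separated set of maximal cardinality is a net
  obtain ⟨s, hs, hmax⟩ : ∃ s, P s ∧ ∀ t, P t → t.card ≤ s.card := by
    have hex : ∃ k s, P s ∧ s.card = k := ⟨0, ∅, by simp [P], rfl⟩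
    have hb : ∀ k, (∃ s, P s ∧ s.card = k) → k ≤ 5 ^ n := by
      rintro k ⟨s, hs, rfl⟩
      exact hcard s hs
    obtain ⟨s, hs, hk⟩ := Nat.sSup_mem (s := {k | ∃ s, P s ∧ s.card = k}) hex ⟨5 ^ n, hb⟩
    exact ⟨s, hs, fun t ht => hk ▸ le_csSup ⟨5 ^ n, hb⟩ ⟨t, ht, rfl⟩⟩
  refine ⟨s.image fun c => (1 / 2 : ℝ) • c, Finset.card_image_le.trans (hcard s hs), ?_, ?_⟩
  · intro x hx
    obtain ⟨c, hc, rfl⟩ := Finset.mem_image.1 hx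
    rw [norm_smul, Real.norm_of_nonneg (by norm_num)]
    linarith [hs.1 c hc]
  · intro x hx
    obtain ⟨c, hc, hxc⟩ : ∃ c ∈ s, ‖(2 : ℝ) • x - c‖ ≤ 1 := by
      by_contra! hcon
      have hx2 : ‖(2 : ℝ) • x‖ ≤ 2 := by
        rw [norm_smul, Real.norm_of_nonneg (by norm_num)]
        linarith
      have hnot : (2 : ℝ) • x ∉ s := fun h => by
        have := hcon _ h
        simp at this
        linarith
      have hP : P (insert ((2 : ℝ) • x) s) := by
        refine ⟨fun c hc => ?_, fun c hc d hd hcd => ?_⟩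
        · rcases Finset.mem_insert.1 hc with rfl | hc
          · exact hx2
          · exact hs.1 c hc
        · rcases Finset.mem_insert.1 hc with rfl | hc <;>
            rcases Finset.mem_insert.1 hd with rfl | hd
          · exact absurd rfl hcd
          · exact (hcon d hd).le
          · rw [norm_sub_rev]
            exact (hcon c hc).le
          · exact hs.2 c hc d hd hcd
      have := hmax _ hP
      rw [Finset.card_insert_of_notMem hnot] at this
      omega
    refine ⟨(1 / 2 : ℝ) • c, Finset.mem_image_of_mem _ hc, ?_⟩
    have : x - (1 / 2 : ℝ) • c = (1 / 2 : ℝ) • ((2 : ℝ) • x - c) := by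
      rw [smul_sub, smul_smul]
      norm_num
    rw [this, norm_smul, Real.norm_of_nonneg (by norm_num)]
    linarith

theorem euclideanOpNorm_le_of_net {n : ℕ} {N : Finset (EuclideanSpace ℝ (Fin n))}
    (hnet : ∀ x : EuclideanSpace ℝ (Fin n), ‖x‖ ≤ 1 → ∃ y ∈ N, ‖x - y‖ ≤ 1 / 2)
    (A : Matrix (Fin n) (Fin n) ℝ) {b : ℝ}
    (hb : ∀ x ∈ N, ∀ y ∈ N, x.ofLp ⬝ᵥ A.mulVec y.ofLp ≤ b) : euclideanOpNorm A ≤ 4 * b := by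
  have hvec : ∀ y ∈ N, ‖Matrix.toEuclideanCLM (n := Fin n) (𝕜 := ℝ) A y‖ ≤ 2 * b := by
    intro y hy
    set v := Matrix.toEuclideanCLM (n := Fin n) (𝕜 := ℝ) A y with hv
    have h1 : ‖(‖v‖⁻¹ : ℝ) • v‖ ≤ 1 := by
      rw [norm_smul, norm_inv, norm_norm]
      exact inv_mul_le_one
    obtain ⟨x, hx, hxv⟩ := hnet _ h1
    have h2 : inner ℝ ((‖v‖⁻¹ : ℝ) • v) v = ‖v‖ := by
      rw [real_inner_smul_left, real_inner_self_eq_norm_sq]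
      by_cases h : ‖v‖ = 0
      · simp [h]
      · field_simp
    have h3 : inner ℝ x v ≤ b := by
      rw [hv, Matrix.inner_toEuclideanCLM]
      exact hb x hx y hy
    have h4 : inner ℝ ((‖v‖⁻¹ : ℝ) • v - x) v ≤ 1 / 2 * ‖v‖ :=
      (real_inner_le_norm _ _).trans (by gcongr)
    rw [inner_sub_left, h2] at h4
    linarith
  have hb0 : 0 ≤ b := by
    obtain ⟨y, hy, -⟩ := hnet 0 (by simp)
    linarith [(norm_nonneg _).trans (hvec y hy)]
  have h : ‖Matrix.toEuclideanCLM (n := Fin n) (𝕜 := ℝ) A‖ ≤ 2 * b + 1 / 2 * euclideanOpNorm A := by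
    refine ContinuousLinearMap.opNorm_le_of_unit_norm
      (add_nonneg (by linarith) (mul_nonneg (by norm_num) (euclideanOpNorm_nonneg A)))
      fun x hx => ?_
    obtain ⟨y, hy, hxy⟩ := hnet x hx.le
    calc ‖Matrix.toEuclideanCLM (n := Fin n) (𝕜 := ℝ) A x‖
        = ‖Matrix.toEuclideanCLM (n := Fin n) (𝕜 := ℝ) A y
            + Matrix.toEuclideanCLM (n := Fin n) (𝕜 := ℝ) A (x - y)‖ := by
          rw [← map_add]; simp
      _ ≤ 2 * b + euclideanOpNorm A * (1 / 2) := (norm_add_le _ _).trans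
          (add_le_add (hvec y hy) (ContinuousLinearMap.le_opNorm_of_le _ hxy))
      _ = _ := by ring
  rw [euclideanOpNorm] at h ⊢
  linarith

theorem euclideanOpNorm_pow_le_sum_net {n : ℕ} {N : Finset (EuclideanSpace ℝ (Fin n))}
    (hnet : ∀ x : EuclideanSpace ℝ (Fin n), ‖x‖ ≤ 1 → ∃ y ∈ N, ‖x - y‖ ≤ 1 / 2)
    (A : Matrix (Fin n) (Fin n) ℝ) (k : ℕ) :
    euclideanOpNorm A ^ (2 * k)
      ≤ 4 ^ (2 * k) * ∑ x ∈ N, ∑ y ∈ N, (x.ofLp ⬝ᵥ A.mulVec y.ofLp) ^ (2 * k) := by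
  obtain ⟨y₀, hy₀, -⟩ := hnet 0 (by simp)
  obtain ⟨q, hq, hmax⟩ := Finset.exists_max_image (N ×ˢ N)
    (fun q => |q.1.ofLp ⬝ᵥ A.mulVec q.2.ofLp|) ⟨(y₀, y₀), Finset.mk_mem_product hy₀ hy₀⟩
  have h1 := euclideanOpNorm_le_of_net hnet A (b := |q.1.ofLp ⬝ᵥ A.mulVec q.2.ofLp|)
    fun x hx y hy => (le_abs_self _).trans (hmax (x, y) (Finset.mk_mem_product hx hy))
  calc euclideanOpNorm A ^ (2 * k) ≤ (4 * |q.1.ofLp ⬝ᵥ A.mulVec q.2.ofLp|) ^ (2 * k) :=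
        pow_le_pow_left₀ (euclideanOpNorm_nonneg A) h1 _
    _ = 4 ^ (2 * k) * (q.1.ofLp ⬝ᵥ A.mulVec q.2.ofLp) ^ (2 * k) := by
        rw [mul_pow, (even_two_mul k).pow_abs]
    _ ≤ _ := by
        gcongr
        rw [← Finset.sum_product']
        exact Finset.single_le_sum (f := fun q : EuclideanSpace ℝ (Fin n) × EuclideanSpace ℝ (Fin n)
          => (q.1.ofLp ⬝ᵥ A.mulVec q.2.ofLp) ^ (2 * k))
          (fun q _ => (even_two_mul k).pow_nonneg _) hq

/-! ### The comparison matrix -/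

/-- The pairs marked in `σ` get the value `2`, the others `-1`. Under the weights `markWeight`, which
mark each pair independently with probability `1/3`, this is centred and has all higher moments at
least `1`. -/
def markValue {V : Type*} (σ : Sym2 V → Bool) (e : Sym2 V) : ℝ :=
  if σ e then 2 else -1

/-- The probability of the set of marks `σ`, when each pair is marked independently with
probability `1/3`. -/
noncomputable def markWeight {V : Type*} [Fintype V] [DecidableEq V] (σ : Sym2 V → Bool) : ℝ :=
  ∏ e, if σ e then 1 / 3 else 2 / 3

theorem markWeight_nonneg {V : Type*} [Fintype V] [DecidableEq V] (σ : Sym2 V → Bool) :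
    0 ≤ markWeight σ :=
  Finset.prod_nonneg fun e _ => by split_ifs <;> norm_num

theorem sum_markWeight_mul_prod {V : Type*} [Fintype V] [DecidableEq V] (f : Sym2 V → ℝ → ℝ) :
    ∑ σ : Sym2 V → Bool, markWeight σ * ∏ e ∈ edgePairs V, f e (markValue σ e)
      = ∏ e ∈ edgePairs V, (1 / 3 * f e 2 + 2 / 3 * f e (-1)) := by
  have h1 : ∀ F : Sym2 V → ℝ, ∏ e ∈ edgePairs V, F e = ∏ e, if e ∈ edgePairs V then F e else 1 :=
    fun F => by rw [Finset.prod_ite_mem, Finset.univ_inter]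
  have h2 : ∀ e, (if e ∈ edgePairs V then (1 / 3 * f e 2 + 2 / 3 * f e (-1)) else 1)
      = ∑ b : Bool, (if b then (1 / 3 : ℝ) else 2 / 3) *
        (if e ∈ edgePairs V then f e (if b then 2 else -1) else 1) := by
    intro e
    rw [Fintype.sum_bool]
    by_cases he : e ∈ edgePairs V
    · simp [he]
    · simp [he]
      norm_num
  rw [h1, Finset.prod_congr rfl fun e _ => h2 e, Fintype.prod_sum]
  refine Finset.sum_congr rfl fun σ _ => ?_
  rw [h1, markWeight, ← Finset.prod_mul_distrib]
  rfl

theorem hasIIDMoments_markValue (V : Type*) [Fintype V] [DecidableEq V] :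
    HasIIDMoments (markWeight (V := V)) markValue fun q => 1 / 3 * 2 ^ q + 2 / 3 * (-1) ^ q :=
  ⟨by norm_num, fun q => sum_markWeight_mul_prod fun e x => x ^ q e⟩

theorem one_le_markMoment {q : ℕ} (hq : 2 ≤ q) : (1 : ℝ) ≤ 1 / 3 * 2 ^ q + 2 / 3 * (-1) ^ q := by
  rcases Nat.even_or_odd q with h | h
  · rw [h.neg_one_pow]
    have : (1 : ℝ) ≤ 2 ^ q := one_le_pow₀ (by norm_num)
    linarith
  · have h3 : 3 ≤ q := by
      rcases h with ⟨m, rfl⟩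
      omega
    rw [h.neg_one_pow]
    have : (2 : ℝ) ^ 3 ≤ 2 ^ q := pow_le_pow_right₀ (by norm_num) h3
    linarith

/-- The comparison variable is subgaussian. -/
theorem third_mul_exp_add_le (s : ℝ) :
    1 / 3 * Real.exp (s * 2) + 2 / 3 * Real.exp (s * (-1)) ≤ Real.exp (4 * s ^ 2) := by
  rcases le_or_gt |s| (1 / 2) with h | h
  · have h1 := abs_le.1 (Real.abs_exp_sub_one_sub_id_le (x := s * 2)
      (by rw [abs_mul, abs_two]; linarith))
    have h2 := abs_le.1 (Real.abs_exp_sub_one_sub_id_le (x := s * (-1))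
      (by rw [abs_mul, abs_neg, abs_one]; linarith))
    have h3 := Real.add_one_le_exp (4 * s ^ 2)
    nlinarith [sq_nonneg s]
  · have h0 : 2 * |s| ≤ 4 * s ^ 2 := by
      rw [← sq_abs]
      nlinarith
    have h1 : Real.exp (s * 2) ≤ Real.exp (4 * s ^ 2) :=
      Real.exp_le_exp.2 (by linarith [le_abs_self s])
    have h2 : Real.exp (s * (-1)) ≤ Real.exp (4 * s ^ 2) :=
      Real.exp_le_exp.2 (by linarith [neg_abs_le s, abs_nonneg s])
    linarith

/-- The coefficient of the variable at the pair `e` in the bilinear form at `(x, y)` of a symmetric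
matrix with zero diagonal. -/
def bilinearCoeff {V : Type*} [Fintype V] [DecidableEq V] (x y : V → ℝ) (e : Sym2 V) : ℝ :=
  ∑ q : V × V with s(q.1, q.2) = e, x q.1 * y q.2

theorem dotProduct_offDiagMatrix_mulVec {V : Type*} [Fintype V] [DecidableEq V]
    (a : Sym2 V → ℝ) (x y : V → ℝ) :
    x ⬝ᵥ (offDiagMatrix a).mulVec y = ∑ e ∈ edgePairs V, bilinearCoeff x y e * a e := by
  have h1 : x ⬝ᵥ (offDiagMatrix a).mulVec y
      = ∑ q : V × V, x q.1 * y q.2 * (offDiagMatrix a q.1 q.2) := by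
    rw [Fintype.sum_prod_type]
    simp only [dotProduct, Matrix.mulVec, Finset.mul_sum]
    exact Finset.sum_congr rfl fun i _ => Finset.sum_congr rfl fun j _ => by ring
  rw [h1, ← Finset.sum_fiberwise Finset.univ (fun q : V × V => s(q.1, q.2)),
    ← Finset.sum_subset (Finset.subset_univ (edgePairs V))]
  · refine Finset.sum_congr rfl fun e he => ?_
    rw [bilinearCoeff, Finset.sum_mul]
    refine Finset.sum_congr rfl fun q hq => ?_
    obtain rfl := (Finset.mem_filter.1 hq).2
    rw [offDiagMatrix, if_neg]
    simpa using mem_edgePairs.1 he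
  · intro e _ he
    refine Finset.sum_eq_zero fun q hq => ?_
    obtain rfl := (Finset.mem_filter.1 hq).2
    rw [mem_edgePairs, not_not] at he
    rw [offDiagMatrix, if_pos (by simpa using he), mul_zero]

theorem sum_bilinearCoeff_sq_le {V : Type*} [Fintype V] [DecidableEq V] (x y : V → ℝ) :
    ∑ e ∈ edgePairs V, bilinearCoeff x y e ^ 2 ≤ 2 * ((∑ i, x i ^ 2) * ∑ j, y j ^ 2) := by
  have h1 : ∀ e : Sym2 V, bilinearCoeff x y e ^ 2
      ≤ 2 * ∑ q : V × V with s(q.1, q.2) = e, (x q.1 * y q.2) ^ 2 := by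
    intro e
    refine sq_sum_le_card_mul_sum_sq.trans ?_
    refine mul_le_mul_of_nonneg_right ?_ (Finset.sum_nonneg fun q _ => sq_nonneg _)
    induction e using Sym2.ind with
    | _ a b =>
      have hsub : (Finset.univ.filter fun q : V × V => s(q.1, q.2) = s(a, b))
          ⊆ {(a, b), (b, a)} := by
        rintro ⟨c, d⟩ hq
        have := Sym2.eq_iff.1 (Finset.mem_filter.1 hq).2
        simpa using this
      exact_mod_cast (Finset.card_le_card hsub).trans Finset.card_le_two
  calc ∑ e ∈ edgePairs V, bilinearCoeff x y e ^ 2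
      ≤ ∑ e, bilinearCoeff x y e ^ 2 :=
        Finset.sum_le_univ_sum_of_nonneg fun e => sq_nonneg _
    _ ≤ ∑ e, 2 * ∑ q : V × V with s(q.1, q.2) = e, (x q.1 * y q.2) ^ 2 :=
        Finset.sum_le_sum fun e _ => h1 e
    _ = 2 * ∑ q : V × V, (x q.1 * y q.2) ^ 2 := by
        rw [← Finset.mul_sum, Finset.sum_fiberwise]
    _ = _ := by
        rw [Finset.sum_mul_sum, Fintype.sum_prod_type]
        simp only [mul_pow]

theorem sum_markWeight_exp_le {n : ℕ} {x y : EuclideanSpace ℝ (Fin n)} (hx : ‖x‖ ≤ 1)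
    (hy : ‖y‖ ≤ 1) (θ : ℝ) :
    ∑ σ, markWeight σ *
        Real.exp (θ * (x.ofLp ⬝ᵥ (offDiagMatrix (markValue σ)).mulVec y.ofLp))
      ≤ Real.exp (8 * θ ^ 2) := by
  have h1 : ∀ σ : Sym2 (Fin n) → Bool,
      Real.exp (θ * (x.ofLp ⬝ᵥ (offDiagMatrix (markValue σ)).mulVec y.ofLp))
        = ∏ e ∈ edgePairs (Fin n), Real.exp (θ * bilinearCoeff x.ofLp y.ofLp e * markValue σ e) := by
    intro σ
    rw [dotProduct_offDiagMatrix_mulVec, Finset.mul_sum, ← Real.exp_sum]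
    simp only [mul_assoc]
  simp only [h1]
  rw [sum_markWeight_mul_prod
    (fun e v => Real.exp (θ * bilinearCoeff x.ofLp y.ofLp e * v))]
  calc _ ≤ ∏ e ∈ edgePairs (Fin n), Real.exp (4 * (θ * bilinearCoeff x.ofLp y.ofLp e) ^ 2) :=
        Finset.prod_le_prod (fun e _ => by positivity) fun e _ => third_mul_exp_add_le _
    _ = Real.exp (4 * θ ^ 2 * ∑ e ∈ edgePairs (Fin n), bilinearCoeff x.ofLp y.ofLp e ^ 2) := by
        rw [← Real.exp_sum, Finset.mul_sum]
        simp only [mul_pow, mul_assoc]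
    _ ≤ _ := by
        refine Real.exp_le_exp.2 ?_
        have h2 := sum_bilinearCoeff_sq_le x.ofLp y.ofLp
        rw [← EuclideanSpace.real_norm_sq_eq, ← EuclideanSpace.real_norm_sq_eq] at h2
        have h3 : ‖x‖ ^ 2 * ‖y‖ ^ 2 ≤ 1 :=
          mul_le_one₀ (pow_le_one₀ (norm_nonneg _) hx) (by positivity)
            (pow_le_one₀ (norm_nonneg _) hy)
        nlinarith [sq_nonneg θ]

theorem pow_even_le_factorial_mul_exp (t : ℝ) (k : ℕ) :
    t ^ (2 * k) ≤ (2 * k).factorial * (Real.exp t + Real.exp (-t)) := by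
  have h1 := Real.pow_div_factorial_le_exp |t| (abs_nonneg t) (2 * k)
  rw [(even_two_mul k).pow_abs, div_le_iff₀ (by positivity)] at h1
  have h2 : Real.exp |t| ≤ Real.exp t + Real.exp (-t) := by
    rcases abs_choice t with h | h <;> rw [h] <;> linarith [Real.exp_pos t, Real.exp_pos (-t)]
  calc t ^ (2 * k) ≤ Real.exp |t| * (2 * k).factorial := h1
    _ ≤ (Real.exp t + Real.exp (-t)) * (2 * k).factorial := by gcongr
    _ = _ := mul_comm _ _

/-- The `2 k`-th moment of a bilinear form of the comparison matrix, from the exponential moment at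
parameter `√k`. -/
theorem sum_markWeight_pow_le {n k : ℕ} (hk : 0 < k) {x y : EuclideanSpace ℝ (Fin n)}
    (hx : ‖x‖ ≤ 1) (hy : ‖y‖ ≤ 1) :
    ∑ σ, markWeight σ * (x.ofLp ⬝ᵥ (offDiagMatrix (markValue σ)).mulVec y.ofLp) ^ (2 * k)
      ≤ 2 * (4 * Real.exp 8 * k) ^ k := by
  have hk' : (0 : ℝ) < k := by exact_mod_cast hk
  set θ : ℝ := Real.sqrt k with hθ
  have hθ2 : θ ^ 2 = k := Real.sq_sqrt hk'.le
  set B : (Sym2 (Fin n) → Bool) → ℝ := fun σ =>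
    x.ofLp ⬝ᵥ (offDiagMatrix (markValue σ)).mulVec y.ofLp with hB
  have h1 : (k : ℝ) ^ k * ∑ σ, markWeight σ * B σ ^ (2 * k)
      ≤ (2 * k).factorial * (2 * Real.exp (8 * k)) := by
    calc (k : ℝ) ^ k * ∑ σ, markWeight σ * B σ ^ (2 * k)
        = ∑ σ, markWeight σ * (θ * B σ) ^ (2 * k) := by
          rw [Finset.mul_sum]
          refine Finset.sum_congr rfl fun σ _ => ?_
          rw [mul_pow θ, pow_mul θ, hθ2]
          ring
      _ ≤ ∑ σ, markWeight σ *
            ((2 * k).factorial * (Real.exp (θ * B σ) + Real.exp (-(θ * B σ)))) :=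
          Finset.sum_le_sum fun σ _ => mul_le_mul_of_nonneg_left
            (pow_even_le_factorial_mul_exp _ _) (markWeight_nonneg σ)
      _ = (2 * k).factorial * (∑ σ, markWeight σ * Real.exp (θ * B σ)
            + ∑ σ, markWeight σ * Real.exp (-θ * B σ)) := by
          rw [← Finset.sum_add_distrib, Finset.mul_sum]
          refine Finset.sum_congr rfl fun σ _ => ?_
          rw [neg_mul]
          ring
      _ ≤ (2 * k).factorial * (Real.exp (8 * θ ^ 2) + Real.exp (8 * (-θ) ^ 2)) := by
          gcongr
          · exact sum_markWeight_exp_le hx hy θ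
          · exact sum_markWeight_exp_le hx hy (-θ)
      _ = _ := by
          rw [neg_sq, hθ2]
          ring
  have h2 : ((2 * k).factorial : ℝ) ≤ (2 * k : ℝ) ^ (2 * k) := by
    exact_mod_cast Nat.factorial_le_pow (2 * k)
  have h3 : Real.exp (8 * k) = Real.exp 8 ^ k := by
    rw [← Real.exp_nat_mul, mul_comm]
  have hpos : (0 : ℝ) < (k : ℝ) ^ k := by positivity
  refine le_of_mul_le_mul_left (h1.trans ?_) hpos
  calc ((2 * k).factorial : ℝ) * (2 * Real.exp (8 * k))
      ≤ (2 * k : ℝ) ^ (2 * k) * (2 * Real.exp (8 * k)) := by gcongr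
    _ = (k : ℝ) ^ k * (2 * (4 * Real.exp 8 * k) ^ k) := by
        rw [h3, pow_mul, show ((2 : ℝ) * k) ^ 2 = 4 * k * k by ring, mul_pow (4 * (k : ℝ)),
          mul_pow 4, mul_pow (4 * Real.exp 8), mul_pow 4]
        ring

/-- The net argument: since the exponent `2 k` equals the dimension, the entropy of the net costs
only a factor that is exponential in `k`. -/
theorem sum_markWeight_trace_pow_le {k : ℕ} (hk : 0 < k) :
    ∑ σ : Sym2 (Fin (2 * k)) → Bool,
        markWeight σ * ((offDiagMatrix (markValue σ)) ^ (2 * k)).trace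
      ≤ (2 * k) * (2 * (40000 * Real.exp 8 * k) ^ k) := by
  obtain ⟨N, hcard, hball, hnet⟩ := exists_half_net (2 * k)
  have hN : (N.card : ℝ) ≤ 25 ^ k := by
    have : (N.card : ℝ) ≤ 5 ^ (2 * k) := by exact_mod_cast hcard
    rwa [pow_mul, show (5 : ℝ) ^ 2 = 25 by norm_num] at this
  calc ∑ σ : Sym2 (Fin (2 * k)) → Bool,
        markWeight σ * ((offDiagMatrix (markValue σ)) ^ (2 * k)).trace
      ≤ ∑ σ : Sym2 (Fin (2 * k)) → Bool, markWeight σ * ((2 * k) * (4 ^ (2 * k) *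
          ∑ x ∈ N, ∑ y ∈ N,
            (x.ofLp ⬝ᵥ (offDiagMatrix (markValue σ)).mulVec y.ofLp) ^ (2 * k))) := by
        refine Finset.sum_le_sum fun σ _ => mul_le_mul_of_nonneg_left ?_ (markWeight_nonneg σ)
        refine (trace_pow_le_mul_euclideanOpNorm_pow _ _).trans ?_
        push_cast
        gcongr
        exact euclideanOpNorm_pow_le_sum_net hnet _ k
    _ = (2 * k) * (4 ^ (2 * k) * ∑ x ∈ N, ∑ y ∈ N, ∑ σ, markWeight σ *
          (x.ofLp ⬝ᵥ (offDiagMatrix (markValue σ)).mulVec y.ofLp) ^ (2 * k)) := by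
        have hswap : ∑ x ∈ N, ∑ y ∈ N, ∑ σ, markWeight σ *
            (x.ofLp ⬝ᵥ (offDiagMatrix (markValue σ)).mulVec y.ofLp) ^ (2 * k)
            = ∑ σ, ∑ x ∈ N, ∑ y ∈ N, markWeight σ *
              (x.ofLp ⬝ᵥ (offDiagMatrix (markValue σ)).mulVec y.ofLp) ^ (2 * k) := by
          rw [Finset.sum_comm]
          rw [Finset.sum_congr rfl fun x _ => Finset.sum_comm]
          rw [Finset.sum_comm]
          rw [Finset.sum_congr rfl fun x _ => Finset.sum_comm]
        rw [hswap, Finset.mul_sum, Finset.mul_sum]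
        refine Finset.sum_congr rfl fun σ _ => ?_
        simp only [← Finset.mul_sum]
        ring
    _ ≤ (2 * k) * (4 ^ (2 * k) * ∑ x ∈ N, ∑ y ∈ N, 2 * (4 * Real.exp 8 * k) ^ k) := by
        gcongr with x hx y hy
        exact sum_markWeight_pow_le hk (hball x hx) (hball y hy)
    _ = (2 * k) * (2 * (16 ^ k * (N.card * N.card) * (4 * Real.exp 8 * k) ^ k)) := by
        rw [Finset.sum_const, Finset.sum_const, nsmul_eq_mul, nsmul_eq_mul, pow_mul,
          show (4 : ℝ) ^ 2 = 16 by norm_num]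
        ring
    -- the base of the resulting power is `16 * 25 * 25 * 4 = 40000` times `exp 8 * k`
    _ ≤ (2 * k) * (2 * (16 ^ k * (25 ^ k * 25 ^ k) * (4 * Real.exp 8 * k) ^ k)) := by
        gcongr
    _ = _ := by
        rw [← mul_pow, ← mul_pow, ← mul_pow]
        congr 3
        ring

/-! ### The norm of the centred measurement matrix -/

/-- The centred measurement of the pair `e`, rescaled by `1/2` so as to have values in `[-1, 1]`. -/
noncomputable def centredEdge {n : ℕ} (p ε : unitInterval)
    (ω : SimpleGraph (Fin n) × SimpleGraph (Fin n)) (e : Sym2 (Fin n)) : ℝ :=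
  (signedEdge ω e - p * (1 - 2 * (ε : ℝ))) / 2

/-- The moments of a rescaled centred measurement. -/
noncomputable def centredMoment (p ε : unitInterval) (q : ℕ) : ℝ :=
  (p : ℝ) * (ε * ((-1 - p * (1 - 2 * (ε : ℝ))) / 2) ^ q +
    (1 - ε) * ((1 - p * (1 - 2 * (ε : ℝ))) / 2) ^ q) +
      (1 - p) * ((0 - p * (1 - 2 * (ε : ℝ))) / 2) ^ q

theorem hasIIDMoments_centredEdge {n : ℕ} (p ε : unitInterval) :
    HasIIDMoments (fun ω : SimpleGraph (Fin n) × SimpleGraph (Fin n) => (model n p ε).real {ω})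
      (centredEdge p ε) (centredMoment p ε) :=
  ⟨by simp [centredMoment], fun q => sum_model_mul_prod_signedEdge p ε
    fun e v => ((v - p * (1 - 2 * (ε : ℝ))) / 2) ^ q e⟩

theorem centredMoment_one (p ε : unitInterval) : centredMoment p ε 1 = 0 := by
  simp only [centredMoment, pow_one]
  ring

theorem abs_centredMoment_le (p ε : unitInterval) {q : ℕ} (hq : 2 ≤ q) :
    |centredMoment p ε q| ≤ p := by
  have hp0 := p.2.1
  have hp1 := p.2.2
  have hε0 := ε.2.1
  have hε1 := ε.2.2
  set a : ℝ := p * (1 - 2 * (ε : ℝ)) with ha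
  have hη : |1 - 2 * (ε : ℝ)| ≤ 1 := abs_le.2 ⟨by linarith, by linarith⟩
  have ha1 : |a| ≤ 1 := by
    rw [ha, abs_mul, abs_of_nonneg hp0]
    exact mul_le_one₀ hp1 (abs_nonneg _) hη
  obtain ⟨ha2, ha3⟩ := abs_le.1 ha1
  have hpow : ∀ v : ℝ, |v| ≤ 1 → |v ^ q| ≤ v ^ 2 := fun v hv => by
    rw [abs_pow, ← sq_abs v]
    exact pow_le_pow_of_le_one (abs_nonneg v) hv hq
  have h1 := hpow ((-1 - a) / 2) (abs_le.2 ⟨by linarith, by linarith⟩)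
  have h2 := hpow ((1 - a) / 2) (abs_le.2 ⟨by linarith, by linarith⟩)
  have h3 := hpow ((0 - a) / 2) (abs_le.2 ⟨by linarith, by linarith⟩)
  have hε1' : (0 : ℝ) ≤ 1 - ε := by linarith
  have hp1' : (0 : ℝ) ≤ 1 - p := by linarith
  calc |centredMoment p ε q|
      ≤ (p : ℝ) * (ε * |((-1 - a) / 2) ^ q| + (1 - ε) * |((1 - a) / 2) ^ q|)
          + (1 - p) * |((0 - a) / 2) ^ q| := by
        rw [centredMoment, ← ha]
        refine (abs_add_le _ _).trans ?_
        rw [abs_mul, abs_mul (1 - (p : ℝ)), abs_of_nonneg hp0, abs_of_nonneg hp1']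
        gcongr
        refine (abs_add_le _ _).trans ?_
        rw [abs_mul, abs_mul (1 - (ε : ℝ)), abs_of_nonneg hε0, abs_of_nonneg hε1']
    _ ≤ (p : ℝ) * (ε * ((-1 - a) / 2) ^ 2 + (1 - ε) * ((1 - a) / 2) ^ 2)
          + (1 - p) * ((0 - a) / 2) ^ 2 := by gcongr
    _ = (p - a ^ 2) / 4 := by
        rw [ha]
        ring
    _ ≤ p := by nlinarith [sq_nonneg a]

theorem offDiagMatrix_transpose {V : Type*} [DecidableEq V] (x : Sym2 V → ℝ) :
    (offDiagMatrix x).transpose = offDiagMatrix x := by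
  ext i j
  simp [offDiagMatrix, eq_comm, Sym2.eq_swap]

/-- Markov's inequality for the trace of the power `2 k`, with `k ≥ n p` a power of two. -/
theorem model_real_le_euclideanOpNorm {n m : ℕ} (p ε : unitInterval)
    (hm : n * (p : ℝ) ≤ 2 ^ m) :
    (model n p ε).real {ω | Real.exp 1 * Real.sqrt (40000 * Real.exp 8 * 2 ^ m)
        ≤ euclideanOpNorm (offDiagMatrix (centredEdge p ε ω))}
      ≤ 2 * n * Real.exp (-(2 * 2 ^ m)) := by
  set k : ℕ := 2 ^ m with hkdef
  have hk : 0 < k := by positivity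
  have hkR : ((2 : ℝ) ^ m) = k := by rw [hkdef]; push_cast; rfl
  rw [hkR] at hm ⊢
  have hk' : (0 : ℝ) < k := by exact_mod_cast hk
  set b : ℝ := 40000 * Real.exp 8 * k with hb
  have hb0 : 0 < b := by positivity
  have htr : ∑ ω : SimpleGraph (Fin n) × SimpleGraph (Fin n), (model n p ε).real {ω} *
      ((offDiagMatrix (centredEdge p ε ω)) ^ (2 * k)).trace ≤ n * (2 * b ^ k) := by
    have h := (hasIIDMoments_centredEdge (n := n) p ε).sum_trace_pow_le
      (hasIIDMoments_markValue (Fin (2 * k))) (centredMoment_one p ε) (by norm_num) p.2.1 p.2.2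
      (fun q hq => abs_centredMoment_le p ε hq) (fun q hq => one_le_markMoment hq) hm
    have h2 := mul_le_mul_of_nonneg_left (sum_markWeight_trace_pow_le hk) (Nat.cast_nonneg (α := ℝ) n)
    refine le_of_mul_le_mul_left ((h.trans h2).trans (le_of_eq ?_))
      (show (0 : ℝ) < 2 * k by positivity)
    ring
  have hge : ∀ ω : SimpleGraph (Fin n) × SimpleGraph (Fin n),
      euclideanOpNorm (offDiagMatrix (centredEdge p ε ω)) ^ (2 * k)
        ≤ ((offDiagMatrix (centredEdge p ε ω)) ^ (2 * k)).trace := fun ω =>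
    euclideanOpNorm_pow_le_trace_pow (offDiagMatrix_transpose _) m
  have hs : (Real.exp 1 * Real.sqrt b) ^ (2 * k) = Real.exp (2 * k) * b ^ k := by
    rw [mul_pow, pow_mul (Real.sqrt b), Real.sq_sqrt hb0.le, ← Real.exp_nat_mul]
    push_cast
    rw [mul_one]
  have hden : 0 < Real.exp (2 * k) * b ^ k := by positivity
  refine (model_real_le_sum p ε _ (fun ω => (Real.exp (2 * k) * b ^ k)⁻¹ *
    ((offDiagMatrix (centredEdge p ε ω)) ^ (2 * k)).trace) ?_ ?_).trans ?_
  · intro ω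
    exact mul_nonneg (by positivity)
      ((pow_nonneg (euclideanOpNorm_nonneg _) _).trans (hge ω))
  · intro ω hω
    rw [inv_mul_eq_div, one_le_div hden, ← hs]
    exact (pow_le_pow_left₀ (by positivity) hω _).trans (hge ω)
  · calc ∑ ω, (model n p ε).real {ω} * ((Real.exp (2 * k) * b ^ k)⁻¹ *
          ((offDiagMatrix (centredEdge p ε ω)) ^ (2 * k)).trace)
        = (Real.exp (2 * k) * b ^ k)⁻¹ * ∑ ω, (model n p ε).real {ω} *
          ((offDiagMatrix (centredEdge p ε ω)) ^ (2 * k)).trace := by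
          rw [Finset.mul_sum]
          exact Finset.sum_congr rfl fun ω _ => by ring
      _ ≤ (Real.exp (2 * k) * b ^ k)⁻¹ * (n * (2 * b ^ k)) := by gcongr
      _ = 2 * n * Real.exp (-(2 * k)) := by
          rw [Real.exp_neg]
          field_simp

/-! ### Exact recovery -/

/-- The event on which the semidefinite program succeeds. The factor `2` undoes the rescaling in
`centredEdge`. -/
theorem exactRecovery_of_rowSum_gt {n : ℕ} {p ε : unitInterval} (hε : (ε : ℝ) ≤ 1 / 2)
    {z : Fin n → ℝ} (hz : ∀ i, z i = 1 ∨ z i = -1)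
    {ω : SimpleGraph (Fin n) × SimpleGraph (Fin n)} {s : ℝ}
    (hrow : ∀ i, 2 * s < ∑ j, signedEdge ω s(i, j))
    (hnorm : euclideanOpNorm (offDiagMatrix (centredEdge p ε ω)) ≤ s) :
    ExactRecovery z (measurements z ω.1 ω.2) := by
  set W : Matrix (Fin n) (Fin n) ℝ := fun i j => signedEdge ω s(i, j) with hWdef
  have hW : ∀ i j, W i j = W j i := fun i j => by simp only [hWdef, Sym2.eq_swap]
  have ha : 0 ≤ (p : ℝ) * (1 - 2 * (ε : ℝ)) := mul_nonneg p.2.1 (by linarith)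
  refine exactRecovery_of_laplacianForm_pos hz
    (fun i j => measurements_eq_mul_signedEdge z ω i j) hW ?_
  refine laplacianForm_pos_of_rowSum_gt hW (fun i => signedEdge_diag ω i) ha hrow fun x => ?_
  have h1 := dotProduct_mulVec_le (offDiagMatrix (centredEdge p ε ω)) (WithLp.toLp 2 x)
    (WithLp.toLp 2 x)
  rw [← sq, EuclideanSpace.real_norm_sq_eq] at h1
  have h2 : ∑ i, ∑ j, (if i = j then 0 else W i j - p * (1 - 2 * (ε : ℝ))) * (x i * x j)
      = 2 * (x ⬝ᵥ (offDiagMatrix (centredEdge p ε ω)).mulVec x) := by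
    simp only [dotProduct, Matrix.mulVec, Finset.mul_sum]
    refine Finset.sum_congr rfl fun i _ => Finset.sum_congr rfl fun j _ => ?_
    rw [offDiagMatrix]
    split_ifs
    · ring
    · rw [centredEdge]
      ring
  rw [h2, mul_assoc]
  refine mul_le_mul_of_nonneg_left (h1.trans ?_) zero_le_two
  exact mul_le_mul_of_nonneg_right hnorm (Finset.sum_nonneg fun i _ => sq_nonneg _)

/-- Non-asymptotic form of the recovery guarantee: the first error term is the union bound over the
row sums, the second comes from the norm of the centred matrix. -/
theorem one_sub_le_model_real_exactRecovery {n : ℕ} (hn : 2 ≤ n) (p ε : unitInterval)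
    (hε : (ε : ℝ) ≤ 1 / 2) (hnp : 1 ≤ n * (p : ℝ)) {z : Fin n → ℝ}
    (hz : ∀ i, z i = 1 ∨ z i = -1) :
    1 - (n * Real.exp ((1 - 2 * (ε : ℝ)) * (800 * Real.exp 5 * Real.sqrt (((n : ℝ) - 1) * p))
          - ((n : ℝ) - 1) * p * (1 - 2 * (ε : ℝ)) ^ 2 / 2) + 2 * n * Real.exp (-(2 * (n * p))))
      ≤ (model n p ε).real {ω | ExactRecovery z (measurements z ω.1 ω.2)} := by
  classical
  -- the power of two `k = 2 ^ (m + 1)` satisfies `n p ≤ k ≤ 2 n p`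
  obtain ⟨m, hm1, hm2⟩ := exists_nat_pow_near hnp (one_lt_two : (1 : ℝ) < 2)
  have hn' : (2 : ℝ) ≤ n := by exact_mod_cast hn
  have hp0 := p.2.1
  have hd : (0 : ℝ) ≤ ((n : ℝ) - 1) * p := mul_nonneg (by linarith) hp0
  have hkd : (2 : ℝ) ^ (m + 1) ≤ 4 * (((n : ℝ) - 1) * p) := by
    rw [pow_succ]
    nlinarith
  set s : ℝ := Real.exp 1 * Real.sqrt (40000 * Real.exp 8 * 2 ^ (m + 1)) with hs
  set t : ℝ := 800 * Real.exp 5 * Real.sqrt (((n : ℝ) - 1) * p) with ht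
  -- `2 * exp 1 * √(40000 * exp 8 * (4 * d)) = 800 * exp 5 * √d`, where `d = (n - 1) * p`
  have hst : 2 * s ≤ t := by
    have h1 : Real.sqrt (40000 * Real.exp 8 * 2 ^ (m + 1))
        ≤ 400 * Real.exp 4 * Real.sqrt (((n : ℝ) - 1) * p) := by
      refine Real.sqrt_le_iff.2 ⟨by positivity, ?_⟩
      rw [mul_pow, Real.sq_sqrt hd, mul_pow, ← Real.exp_nat_mul]
      norm_num
      nlinarith [Real.exp_pos 8]
    have h2 : Real.exp 5 = Real.exp 1 * Real.exp 4 := by rw [← Real.exp_add]; norm_num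
    rw [ht, h2, hs]
    nlinarith [mul_le_mul_of_nonneg_left h1 (Real.exp_pos 1).le]
  set S : Set (SimpleGraph (Fin n) × SimpleGraph (Fin n)) :=
    {ω | ExactRecovery z (measurements z ω.1 ω.2)} with hS
  have hcover : (Set.univ : Set (SimpleGraph (Fin n) × SimpleGraph (Fin n))) ⊆
      S ∪ ((⋃ i ∈ (Finset.univ : Finset (Fin n)), {ω | ∑ j, signedEdge ω s(i, j) ≤ t}) ∪
        {ω | s ≤ euclideanOpNorm (offDiagMatrix (centredEdge p ε ω))}) := by
    intro ω _
    by_contra hcon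
    simp only [Set.mem_union, Set.mem_iUnion, Set.mem_ofPred_eq, Finset.mem_univ, exists_true_left,
      not_or, not_exists, not_le] at hcon
    exact hcon.1 (exactRecovery_of_rowSum_gt hε hz
      (fun i => hst.trans_lt (hcon.2.1 i)) hcon.2.2.le)
  have h1 : (1 : ℝ) ≤ (model n p ε).real S + (∑ _i : Fin n,
      Real.exp ((1 - 2 * (ε : ℝ)) * t - ((n : ℝ) - 1) * p * (1 - 2 * (ε : ℝ)) ^ 2 / 2)
        + 2 * n * Real.exp (-(2 * 2 ^ (m + 1)))) := by
    calc (1 : ℝ) = (model n p ε).real Set.univ := probReal_univ.symm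
      _ ≤ _ := measureReal_mono hcover
      _ ≤ _ := measureReal_union_le _ _
      _ ≤ _ := by
          gcongr
          refine (measureReal_union_le _ _).trans ?_
          gcongr
          · refine (measureReal_biUnion_finset_le _ _).trans ?_
            exact Finset.sum_le_sum fun i _ => model_real_rowSum_le p ε hε i t
          · exact model_real_le_euclideanOpNorm p ε hm2.le
  have h2 : Real.exp (-(2 * 2 ^ (m + 1))) ≤ Real.exp (-(2 * (n * (p : ℝ)))) :=
    Real.exp_le_exp.2 (by linarith)
  have h3 : 2 * (n : ℝ) * Real.exp (-(2 * 2 ^ (m + 1)))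
      ≤ 2 * n * Real.exp (-(2 * (n * (p : ℝ)))) := by gcongr
  rw [Finset.sum_const, Finset.card_univ, Fintype.card_fin, nsmul_eq_mul] at h1
  linarith

end Z2Sync

theorem mainTheorem6 :
    ∃ K : ℝ, ∀ δ : ℝ, 0 < δ →
      ∃ c : ℝ, 0 < c ∧ ∃ N : ℕ, ∀ n : ℕ, N ≤ n →
        ∀ p ε : unitInterval, (ε : ℝ) < 1 / 2 → (p : ℝ) * (1 - 2 * (ε : ℝ)) ^ 2 ≤ 1 / 2 →
          (1 + δ) * (2 / (1 - 2 * (ε : ℝ)) ^ 2) *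
              (1 + K / Real.sqrt (Real.log (n : ℝ)) + 5 / 3 * (1 - 2 * (ε : ℝ))) *
                Real.log (n : ℝ) ≤ ((n : ℝ) - 1) * (p : ℝ) →
            ∀ z : Fin n → ℝ, (∀ i, z i = 1 ∨ z i = -1) →
              1 - (n : ℝ) ^ (-c) ≤
                (Z2Sync.model n p ε).real
                  {ω | Z2Sync.ExactRecovery z (Z2Sync.measurements z ω.1 ω.2)} := by
  -- The norm bound costs a relative error of order `1 / √(log n)` in the exponent. The factor
  -- `1 + δ` absorbs it once `n` is large in terms of `δ`, so that `K = 0` is admissible.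
  refine ⟨0, fun δ hδ => ?_⟩
  set C : ℝ := 800 * Real.exp 5 with hC
  have hC0 : 0 < C := by positivity
  set c : ℝ := min (δ / 4) 1 with hc
  have hc0 : 0 < c := lt_min (by linarith) one_pos
  set v₀ : ℝ := 4 * C * (1 + δ) / δ with hv₀
  have hv₀0 : 0 < v₀ := by positivity
  obtain ⟨N, hN⟩ := Filter.eventually_atTop.1
    ((Real.tendsto_log_atTop.comp tendsto_natCast_atTop_atTop).eventually_ge_atTop
      (max (v₀ ^ 2) (max (Real.log 3 / c) 1)))
  refine ⟨c, hc0, max N 2, fun n hn p ε hε _ hmain z hz => ?_⟩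
  have hlog : max (v₀ ^ 2) (max (Real.log 3 / c) 1) ≤ Real.log n := hN n (le_of_max_le_left hn)
  have hn2 : 2 ≤ n := le_of_max_le_right hn
  have hn2' : (2 : ℝ) ≤ n := by exact_mod_cast hn2
  have hn0 : (0 : ℝ) < n := by linarith
  set L : ℝ := Real.log n with hL
  have hL1 : v₀ ^ 2 ≤ L := (le_max_left _ _).trans hlog
  have hL2 : Real.log 3 / c ≤ L := (le_max_left _ _).trans ((le_max_right _ _).trans hlog)
  have hL3 : 1 ≤ L := (le_max_right _ _).trans ((le_max_right _ _).trans hlog)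
  set η : ℝ := 1 - 2 * (ε : ℝ) with hη
  have hη0 : 0 < η := by rw [hη]; linarith
  have hη1 : η ≤ 1 := by rw [hη]; linarith [ε.2.1]
  set d : ℝ := ((n : ℝ) - 1) * p with hd
  have hd0 : 0 ≤ d := mul_nonneg (by linarith) p.2.1
  have hu : 2 * (1 + δ) * L ≤ d * η ^ 2 := by
    have h1 : (1 + δ) * (2 / η ^ 2) * L ≤ d := by
      refine le_trans ?_ hmain
      rw [zero_div, add_zero]
      have h2 : 0 ≤ (1 + δ) * (2 / η ^ 2) := by positivity
      have h3 : (1 : ℝ) ≤ 1 + 5 / 3 * η := by linarith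
      exact mul_le_mul_of_nonneg_right (le_mul_of_one_le_right h2 h3) (by linarith)
    calc 2 * (1 + δ) * L = (1 + δ) * (2 / η ^ 2) * L * η ^ 2 := by field_simp
      _ ≤ d * η ^ 2 := by gcongr
  have hdL : 2 * L ≤ d := by
    have h1 : d * η ^ 2 ≤ d := mul_le_of_le_one_right hd0 (pow_le_one₀ hη0.le hη1)
    nlinarith
  have hdn : d ≤ n * p := by
    rw [hd]
    linarith [p.2.1]
  refine le_trans ?_ (Z2Sync.one_sub_le_model_real_exactRecovery hn2 p ε hε.le (by linarith) hz)
  rw [← hη, ← hd, ← hC]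
  -- `v = √(d η²)` is the signal-to-noise ratio of a row sum.
  set v : ℝ := η * Real.sqrt d with hv
  have hv2 : v ^ 2 = d * η ^ 2 := by rw [hv, mul_pow, Real.sq_sqrt hd0, mul_comm]
  have hvv : v₀ ≤ v := by
    refine (sq_le_sq₀ hv₀0.le (by positivity)).1 ?_
    rw [hv2]
    nlinarith
  have hexp : η * (C * Real.sqrt d) - d * η ^ 2 / 2 ≤ -(1 + δ / 2) * L := by
    have h1 : C * v ≤ δ / (4 * (1 + δ)) * v ^ 2 := by
      have h2 : C = δ / (4 * (1 + δ)) * v₀ := by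
        rw [hv₀]
        field_simp
      have h6 : C ≤ δ / (4 * (1 + δ)) * v := h2.le.trans (by gcongr)
      calc C * v ≤ δ / (4 * (1 + δ)) * v * v :=
            mul_le_mul_of_nonneg_right h6 (hv₀0.le.trans hvv)
        _ = _ := by ring
    have h3 : η * (C * Real.sqrt d) = C * v := by rw [hv]; ring
    have h4 : (1 / 2 - δ / (4 * (1 + δ))) * (2 * (1 + δ) * L)
        ≤ (1 / 2 - δ / (4 * (1 + δ))) * v ^ 2 := by
      refine mul_le_mul_of_nonneg_left (hv2 ▸ hu) ?_
      rw [sub_nonneg, div_le_div_iff₀ (by positivity) two_pos]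
      linarith
    have h5 : (1 / 2 - δ / (4 * (1 + δ))) * (2 * (1 + δ) * L) = (1 + δ / 2) * L := by
      field_simp
      ring
    rw [h3, ← hv2]
    linarith
  have hnexp : (n : ℝ) = Real.exp L := (Real.exp_log hn0).symm
  have hrpow : (n : ℝ) ^ (-c) = Real.exp (-(c * L)) := by
    rw [Real.rpow_def_of_pos hn0]
    congr 1
    ring
  have hcδ : c ≤ δ / 4 := min_le_left _ _
  have hc1 : c ≤ 1 := min_le_right _ _
  have hA : n * Real.exp (η * (C * Real.sqrt d) - d * η ^ 2 / 2) ≤ Real.exp (-(2 * c * L)) := by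
    rw [hnexp, ← Real.exp_add]
    refine Real.exp_le_exp.2 ?_
    nlinarith
  have hB : n * Real.exp (-(2 * (n * p))) ≤ Real.exp (-(2 * c * L)) := by
    nth_rewrite 1 [hnexp]
    rw [← Real.exp_add]
    refine Real.exp_le_exp.2 ?_
    nlinarith
  have h3 : 3 * Real.exp (-(2 * c * L)) ≤ Real.exp (-(c * L)) := by
    have h4 : (3 : ℝ) ≤ Real.exp (c * L) := by
      rw [← Real.exp_log (show (0 : ℝ) < 3 by norm_num)]
      refine Real.exp_le_exp.2 ?_
      rw [div_le_iff₀ hc0] at hL2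
      linarith
    calc 3 * Real.exp (-(2 * c * L)) ≤ Real.exp (c * L) * Real.exp (-(2 * c * L)) := by gcongr
      _ = Real.exp (-(c * L)) := by
        rw [← Real.exp_add]
        congr 1
        ring
  rw [hrpow]
  linarith
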